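/- Let $\frac13<\alpha<\nu<\frac12$. Matrices carry the Euclidean (Frobenius) norm when they are values of paths, and linear maps carry the operator norm: $\|A\|$ is the operator norm of $A\in\mathbb R^{d\times d}$ on $\mathbb R^d$, and for $C=(C_1,\dots,C_m)$, $C_j\in\mathbb R^{d\times d}$, $\|C\|$ is the operator norm of $y\mapsto Cy=(C_1y,\dots,C_my)$ from $\mathbb R^d$ to $\mathbb R^{d\times m}$. For a path write $x_{s,t}=x_t-x_s$, and put $[Z]_{\beta,[a,b]}=\sup_{a\le s<t\le b}\|Z_{s,t}\|/(t-s)^\beta$. A rough path of class $C^\beta$ on $[a,b]$ is a pair $\mathbf x=(x,\mathbb X)$ with values in $\mathbb R^m$, $\mathbb R^{m\times m}$, such that $[x]_\beta,[\mathbb X]_{2\beta}<\infty$ and $\mathbb X_{s,t}-\mathbb X_{s,u}-\mathbb X_{u,t}=x_{u,t}\otimes x_{s,u}$ for $s\le u\le t$; put $[\mathbf x]_{\alpha,I}=[x]_{\alpha,I}+[\mathbb X]_{2\alpha,I}^{1/2}$. A pair $(z,z')$ is controlled by $x$ if $[z]_\alpha,[z']_\alpha,[R^z]_{2\alpha}<\infty$,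 where $R^z_{s,t}=z_{s,t}-z'_sx_{s,t}$; put $[z,z']_{x,2\alpha,I}=[z']_{\alpha,I}+[R^z]_{2\alpha,I}$. For $z$ with values in $\mathbb R^{d\times m}$, $\int_s^tz\,dx$ is the limit, as the mesh tends to zero, of the sums of $z_ux_{u,v}+z'_u\mathbb X_{u,v}$ over the partition intervals $[u,v]$, where $(z'\mathbb X)^i=\sum_{j,k}(\partial_kz^{ij})\,\mathbb X^{jk}$ and $z'=(\partial_kz^{ij})$. **Theorem.** (i) There is a constant $C_\alpha>1$, depending only on $\alpha$, such that for all $d,m$, all intervals of length at most $1$, all rough paths of class $C^\alpha$ and all controlled $(z,z')$ on such an interval, and all $s\le t$ in it, the rough integral exists and $$\Big\|\int_s^tz\,dx-z_sx_{s,t}-z'_s\mathbb X_{s,t}\Big\|\le C_\alpha|t-s|^{3\alpha}\big([x]_{\alpha,[s,t]}[R^z]_{2\alpha,[s,t]}+[z']_{\alpha,[s,t]}[\mathbb X]_{2\alpha,[s,t]}\big).\qquad(*)$$ (ii) Let $C_\alpha>1$ be any constant for which $(*)$ holds in this sense. Let $A\in\mathbb R^{d\times d}$, $C$ as above, and let $f:\mathbb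 R^d\to\mathbb R^d$ be locally Lipschitz with $f(0)=0$ and $\|f(v)\|\le\|v\|\,h(\|v\|)$ for all $v$, where $h:[0,\infty)\to[0,C_f]$ is nondecreasing. Let $a<b$, let $\mathbf x$ be a rough path of class $C^\nu$ on $[a,b]$, and let $(y,y')$, $y'=Cy$, be a path controlled by $x$ that solves $$y_t=y_a+\int_a^t[Ay_u+f(y_u)]\,du+\int_a^tCy_u\,dx_u,\qquad t\in[a,b]$$ (rough integral with $(Cy)'=Cy'$). Let $\mu\in(0,1)$, $M=\max\{[\|A\|+C_f+\|C\|(1+C_\alpha)](1+\|C\|),\frac12\}$, and let $0<\gamma<1$ with $\gamma\le\mu/M$ (in particular $\gamma=\mu/M$ when $\mu<M$, and always $\gamma=\mu/(2M)$). Define the greedy times $\bar\tau_0=a$, $$\bar\tau_{i+1}=\inf\{t>\bar\tau_i:(t-\bar\tau_i)^{1-2\alpha}+[\mathbf x]_{\alpha,[\bar\tau_i,t]}=\gamma\}\wedge b .$$ Then $\bar\tau_i=b$ for some $i$; and if $\bar N=\bar N_{\gamma,[a,b],\alpha}(\mathbf x)$ is the least such $i$, i.e. the number of greedy times in $[a,b)$,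 then $$[y,y']_{x,2\alpha,[a,b]}\le\|y_a\|\exp\Big\{\bar N\log\Big(\mu+\frac1{1-\mu}\Big)\Big\},\qquad \sup_{t\in[a,b]}\|y_t\|\le\|y_a\|\exp\Big\{\bar N\log\Big(\mu+\frac1{1-\mu}\Big)\Big\}.$$ -/

import Mathlib

open Set Filter Topology

noncomputable section

namespace RoughLinear

/-- `[Z]_{β,[a,b]} = sup_{a ≤ s < t ≤ b} ‖Z_{s,t}‖ / (t - s)^β` for a two-parameter function `Z`. -/
def holderSemi₂ {E : Type*} [NormedAddCommGroup E] (β : ℝ) (Z : ℝ → ℝ → E) (a b : ℝ) : ℝ :=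
  sSup {r : ℝ | ∃ s t : ℝ, a ≤ s ∧ s < t ∧ t ≤ b ∧ r = ‖Z s t‖ / (t - s) ^ β}

/-- Finiteness of `[Z]_{β,[a,b]}`. -/
def HolderBdd₂ {E : Type*} [NormedAddCommGroup E] (β : ℝ) (Z : ℝ → ℝ → E) (a b : ℝ) : Prop :=
  ∃ K : ℝ, ∀ s t : ℝ, a ≤ s → s < t → t ≤ b → ‖Z s t‖ ≤ K * (t - s) ^ β

/-- The increments `z_{s,t} = z_t - z_s` of a path. -/
def incr {E : Type*} [NormedAddCommGroup E] (z : ℝ → E) (s t : ℝ) : E := z t - z s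

/-- Supremum norm of a path on `[a,b]`. -/
def supNorm {E : Type*} [NormedAddCommGroup E] (z : ℝ → E) (a b : ℝ) : ℝ :=
  sSup ((fun t => ‖z t‖) '' Icc a b)

/-- A `β`-Hölder rough path `(x, X)` over `ℝ^m` on `[a,b]`. `X_{s,t}` is an `m × m` matrix with the
Euclidean (Frobenius) norm; its entry `(j,k)` plays the role of `∫_s^t x^k_{s,r} dx^j_r`. -/
structure IsRoughPath {m : ℕ} (β : ℝ) (x : ℝ → EuclideanSpace ℝ (Fin m))
    (X : ℝ → ℝ → EuclideanSpace ℝ (Fin m × Fin m)) (a b : ℝ) : Prop where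
  holder : HolderBdd₂ β (incr x) a b
  holder₂ : HolderBdd₂ (2 * β) X a b
  chen : ∀ s u t : ℝ, a ≤ s → s ≤ u → u ≤ t → t ≤ b → ∀ j k : Fin m,
    X s t (j, k) - X s u (j, k) - X u t (j, k) = incr x u t j * incr x s u k

/-- The rough path seminorm `[x]_{α,[a,b]} + ([X]_{2α,[a,b]})^{1/2}`. -/
def roughSemi {m : ℕ} (α : ℝ) (x : ℝ → EuclideanSpace ℝ (Fin m))
    (X : ℝ → ℝ → EuclideanSpace ℝ (Fin m × Fin m)) (a b : ℝ) : ℝ :=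
  holderSemi₂ α (incr x) a b + Real.sqrt (holderSemi₂ (2 * α) X a b)

/-- A matrix `z` (rows indexed by `ι`, columns by `Fin m`, Euclidean norm), applied to `v ∈ ℝ^m`. -/
def act {ι : Type*} {m : ℕ} (z : EuclideanSpace ℝ (ι × Fin m))
    (v : EuclideanSpace ℝ (Fin m)) : EuclideanSpace ℝ ι :=
  WithLp.toLp 2 fun i => ∑ j, z (i, j) * v j

/-- The contraction `z' X ∈ ℝ^d` of `z' ∈ L(ℝ^m, L(ℝ^m, ℝ^d))` with `X ∈ ℝ^m ⊗ ℝ^m`; here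
`z' ((i,j),k)` is the derivative of the entry `z (i,j)` in the direction `k`. -/
def act₂ {d m : ℕ} (z' : EuclideanSpace ℝ ((Fin d × Fin m) × Fin m))
    (X : EuclideanSpace ℝ (Fin m × Fin m)) : EuclideanSpace ℝ (Fin d) :=
  WithLp.toLp 2 fun i => ∑ j, ∑ k, z' ((i, j), k) * X (j, k)

/-- The remainder `R^z_{s,t} = z_{s,t} - z'_s x_{s,t}`. -/
def remainder {ι : Type*} [Fintype ι] {m : ℕ} (x : ℝ → EuclideanSpace ℝ (Fin m))
    (z : ℝ → EuclideanSpace ℝ ι) (z' : ℝ → EuclideanSpace ℝ (ι × Fin m)) (s t : ℝ) :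
    EuclideanSpace ℝ ι :=
  incr z s t - act (z' s) (incr x s t)

/-- `(z, z')` belongs to the space `D_x^{2α}([a,b])` of paths controlled by `x`. -/
structure IsControlled {ι : Type*} [Fintype ι] {m : ℕ} (α : ℝ) (x : ℝ → EuclideanSpace ℝ (Fin m))
    (z : ℝ → EuclideanSpace ℝ ι) (z' : ℝ → EuclideanSpace ℝ (ι × Fin m)) (a b : ℝ) : Prop where
  path : HolderBdd₂ α (incr z) a b
  deriv : HolderBdd₂ α (incr z') a b
  rem : HolderBdd₂ (2 * α) (remainder x z z') a b

/-- The seminorm `[z']_{α,[a,b]} + [R^z]_{2α,[a,b]}` on controlled paths. -/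
def controlledSemi {ι : Type*} [Fintype ι] {m : ℕ} (α : ℝ) (x : ℝ → EuclideanSpace ℝ (Fin m))
    (z : ℝ → EuclideanSpace ℝ ι) (z' : ℝ → EuclideanSpace ℝ (ι × Fin m)) (a b : ℝ) : ℝ :=
  holderSemi₂ α (incr z') a b + holderSemi₂ (2 * α) (remainder x z z') a b

/-- The compensated increment `z_s x_{s,t} + z'_s X_{s,t}`. -/
def germ {d m : ℕ} (x : ℝ → EuclideanSpace ℝ (Fin m))
    (X : ℝ → ℝ → EuclideanSpace ℝ (Fin m × Fin m))
    (z : ℝ → EuclideanSpace ℝ (Fin d × Fin m))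
    (z' : ℝ → EuclideanSpace ℝ ((Fin d × Fin m) × Fin m)) (s t : ℝ) : EuclideanSpace ℝ (Fin d) :=
  act (z s) (incr x s t) + act₂ (z' s) (X s t)

/-- `J` is the rough integral `∫_s^t z dx`: the limit of the compensated Riemann sums over the
partitions `s = p 0 ≤ p 1 ≤ ⋯ ≤ p n = t` as the mesh tends to zero. -/
def IsRoughIntegral {d m : ℕ} (x : ℝ → EuclideanSpace ℝ (Fin m))
    (X : ℝ → ℝ → EuclideanSpace ℝ (Fin m × Fin m))
    (z : ℝ → EuclideanSpace ℝ (Fin d × Fin m))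
    (z' : ℝ → EuclideanSpace ℝ ((Fin d × Fin m) × Fin m)) (s t : ℝ)
    (J : EuclideanSpace ℝ (Fin d)) : Prop :=
  ∀ ε > 0, ∃ δ > 0, ∀ (n : ℕ) (p : ℕ → ℝ), p 0 = s → p n = t →
    (∀ i < n, p i ≤ p (i + 1) ∧ p (i + 1) - p i < δ) →
    ‖(∑ i ∈ Finset.range n, germ x X z z' (p i) (p (i + 1))) - J‖ < ε

/-- `K > 1` is an admissible constant in the estimate of rough integrals on intervals of length at
most one: every controlled path is integrable and
`‖∫_s^t z dx - z_s x_{s,t} - z'_s X_{s,t}‖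
  ≤ K |t-s|^{3α} ([x]_{α,[s,t]} [R^z]_{2α,[s,t]} + [z']_{α,[s,t]} [X]_{2α,[s,t]})`. -/
def IsRoughConst (α K : ℝ) : Prop :=
  1 < K ∧ ∀ (d m : ℕ) (a b : ℝ), a < b → b - a ≤ 1 →
    ∀ (x : ℝ → EuclideanSpace ℝ (Fin m)) (X : ℝ → ℝ → EuclideanSpace ℝ (Fin m × Fin m)),
    IsRoughPath α x X a b →
    ∀ (z : ℝ → EuclideanSpace ℝ (Fin d × Fin m))
      (z' : ℝ → EuclideanSpace ℝ ((Fin d × Fin m) × Fin m)),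
    IsControlled α x z z' a b →
    ∀ s t : ℝ, a ≤ s → s ≤ t → t ≤ b →
      ∃ J : EuclideanSpace ℝ (Fin d), IsRoughIntegral x X z z' s t J ∧
        ‖J - germ x X z z' s t‖ ≤ K * (t - s) ^ (3 * α) *
          (holderSemi₂ α (incr x) s t * holderSemi₂ (2 * α) (remainder x z z') s t
            + holderSemi₂ α (incr z') s t * holderSemi₂ (2 * α) X s t)

/-- The linear map `y ↦ C y = (C_1 y, …, C_m y)` from `ℝ^d` to the `d × m` matrices with the
Euclidean norm. -/
def diffusion {d m : ℕ} (C : Fin m → Matrix (Fin d) (Fin d) ℝ) :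
    EuclideanSpace ℝ (Fin d) →L[ℝ] EuclideanSpace ℝ (Fin d × Fin m) :=
  LinearMap.toContinuousLinearMap
    { toFun := fun y => WithLp.toLp 2 fun p => ∑ l, C p.2 p.1 l * y l
      map_add' := by
        intro y w
        ext p
        simp [mul_add, Finset.sum_add_distrib]
      map_smul' := by
        intro c y
        ext p
        simp [Finset.mul_sum, mul_left_comm] }

/-- The Gubinelli derivative `(C y)' = C y'`, column by column: `(C y') e_k = C (y' e_k)`. -/
def diffusionDeriv {d m : ℕ} (C : Fin m → Matrix (Fin d) (Fin d) ℝ)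
    (w : EuclideanSpace ℝ (Fin d × Fin m)) : EuclideanSpace ℝ ((Fin d × Fin m) × Fin m) :=
  WithLp.toLp 2 fun q => diffusion C (WithLp.toLp 2 fun l => w (l, q.2)) q.1

/-- `(y, y')` solves `dy = [A y + f(y)] dt + C y dx` on `[a,b]`, in the sense of controlled paths
with `y' = C y`. -/
structure IsSolution {d m : ℕ} (α : ℝ) (A : Matrix (Fin d) (Fin d) ℝ)
    (f : EuclideanSpace ℝ (Fin d) → EuclideanSpace ℝ (Fin d))
    (C : Fin m → Matrix (Fin d) (Fin d) ℝ) (x : ℝ → EuclideanSpace ℝ (Fin m))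
    (X : ℝ → ℝ → EuclideanSpace ℝ (Fin m × Fin m)) (a b : ℝ)
    (y : ℝ → EuclideanSpace ℝ (Fin d)) (y' : ℝ → EuclideanSpace ℝ (Fin d × Fin m)) : Prop where
  controlled : IsControlled α x y y' a b
  deriv_eq : ∀ t ∈ Icc a b, y' t = diffusion C (y t)
  equation : ∀ t ∈ Icc a b,
    IsRoughIntegral x X (fun u => diffusion C (y u)) (fun u => diffusionDeriv C (y' u)) a t
      (y t - y a - ∫ u in a..t, (Matrix.toEuclideanCLM (𝕜 := ℝ) A (y u) + f (y u)))

/-- The greedy times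
`τ_0 = a`, `τ_{i+1} = inf {t > τ_i : (t - τ_i)^{1-2α} + [(x,X)]_{α,[τ_i,t]} = γ} ∧ b`. -/
def greedyTime {m : ℕ} (γ α : ℝ) (x : ℝ → EuclideanSpace ℝ (Fin m))
    (X : ℝ → ℝ → EuclideanSpace ℝ (Fin m × Fin m)) (a b : ℝ) : ℕ → ℝ
  | 0 => a
  | i + 1 =>
    sInf ({t : ℝ | greedyTime γ α x X a b i < t ∧ t ≤ b ∧
        (t - greedyTime γ α x X a b i) ^ (1 - 2 * α)
          + roughSemi α x X (greedyTime γ α x X a b i) t = γ} ∪ {b})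

/-- The number of greedy times in `[a,b)`, that is, the first index at which they reach `b`. -/
def greedyCount {m : ℕ} (γ α : ℝ) (x : ℝ → EuclideanSpace ℝ (Fin m))
    (X : ℝ → ℝ → EuclideanSpace ℝ (Fin m × Fin m)) (a b : ℝ) : ℕ :=
  sInf {i : ℕ | greedyTime γ α x X a b i = b}

/-- `M = max {[‖A‖ + C_f + ‖C‖ (1 + K)] (1 + ‖C‖), 1/2}`, with operator norms. -/
def bigM {d m : ℕ} (A : Matrix (Fin d) (Fin d) ℝ) (Cf : ℝ)
    (C : Fin m → Matrix (Fin d) (Fin d) ℝ) (K : ℝ) : ℝ :=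
  max (((‖Matrix.toEuclideanCLM (𝕜 := ℝ) A‖ + Cf) + ‖diffusion C‖ * (1 + K))
    * (1 + ‖diffusion C‖)) (1 / 2)

end RoughLinear

end

/-! On one greedy interval the solution satisfies a closed system of linear inequalities, and the
exponential bound comes from gluing these intervals together. Inserting the equation into the
remainder writes R^y as drift, plus the second-level term (Cy)'X, plus the error of the rough
integral. By (*) this bounds [R^y] linearly in sup‖y‖, [y'] and [R^y] itself
(`IsSolution.norm_remainder_sub_le`). With y' = Cy and y_{s,t} = (Cy_s)x_{s,t} + R^y_{s,t} the
system closes. Since γM ≤ μ, it can be solved with ρ = 1/(1-μ): on the interval, sup‖y‖ is at most ρ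
times the norm of the initial value, and both [y]_α and the controlled seminorm are at most μρ times
that norm (`closed_bounds_of_linear_bounds`, `IsSolution.interval_estimate`).

Gluing (`IsSolution.greedy_estimate`): after k intervals sup‖y‖ ≤ ρ^k‖y_a‖, and [y]_α ≤ (ρ^k-1)‖y_a‖
because μρ = ρ-1 telescopes. The remainder is not additive; it picks up the cross term
y'_{s,u}x_{u,t}. As ‖C‖γ ≤ μ, this costs at most μ(ρ^k-1)‖y_a‖. Hence the controlled seminorm grows
by at most a factor μ+ρ per interval, which is the base in the theorem.

Two supports are needed. The constant in (*) comes from a sewing argument with exponent 3α > 1. The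
greedy times reach b because ν > α makes the control continuous and uniformly small on short
intervals. -/

noncomputable section

namespace RoughLinear

/-! ### Calculus of Hölder seminorms -/

section Holder

variable {E : Type*} [NormedAddCommGroup E] {β a b : ℝ} {Z : ℝ → ℝ → E}

lemma holderSemi₂_nonneg (β : ℝ) (Z : ℝ → ℝ → E) (a b : ℝ) : 0 ≤ holderSemi₂ β Z a b := by
  refine Real.sSup_nonneg ?_
  rintro r ⟨s, t, -, hst, -, rfl⟩
  have := sub_pos.2 hst
  positivity

/-- The sign of `K` covers `b ≤ a`, where the set of quotients is empty and its `sSup` is 0. -/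
lemma holderSemi₂_le {K : ℝ} (hK : 0 ≤ K)
    (h : ∀ s t, a ≤ s → s < t → t ≤ b → ‖Z s t‖ ≤ K * (t - s) ^ β) :
    holderSemi₂ β Z a b ≤ K := by
  refine Real.sSup_le ?_ hK
  rintro r ⟨s, t, hs, hst, ht, rfl⟩
  have := sub_pos.2 hst
  rw [div_le_iff₀ (by positivity)]
  exact h s t hs hst ht

lemma HolderBdd₂.bddAbove (h : HolderBdd₂ β Z a b) :
    BddAbove {r : ℝ | ∃ s t : ℝ, a ≤ s ∧ s < t ∧ t ≤ b ∧ r = ‖Z s t‖ / (t - s) ^ β} := by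
  obtain ⟨K, hK⟩ := h
  refine ⟨K, ?_⟩
  rintro r ⟨s, t, hs, hst, ht, rfl⟩
  have := sub_pos.2 hst
  rw [div_le_iff₀ (by positivity)]
  exact hK s t hs hst ht

/-- Finiteness matters: an unbounded set of reals has `sSup` equal to 0, and the seminorm would then
control nothing. -/
lemma HolderBdd₂.norm_le (h : HolderBdd₂ β Z a b) {s t : ℝ} (hs : a ≤ s) (hst : s < t)
    (ht : t ≤ b) : ‖Z s t‖ ≤ holderSemi₂ β Z a b * (t - s) ^ β := by
  have := sub_pos.2 hst
  rw [← div_le_iff₀ (by positivity)]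
  exact le_csSup h.bddAbove ⟨s, t, hs, hst, ht, rfl⟩

lemma HolderBdd₂.norm_le' (h : HolderBdd₂ β Z a b) {s t : ℝ} (hs : a ≤ s) (hst : s ≤ t)
    (ht : t ≤ b) (h0 : Z s s = 0) : ‖Z s t‖ ≤ holderSemi₂ β Z a b * (t - s) ^ β := by
  rcases hst.eq_or_lt with rfl | hlt
  · rw [h0, norm_zero]
    have := holderSemi₂_nonneg β Z a b
    have := Real.rpow_nonneg (sub_nonneg.2 le_rfl : (0 : ℝ) ≤ s - s) β
    positivity
  · exact h.norm_le hs hlt ht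

lemma HolderBdd₂.mono {a' b' : ℝ} (h : HolderBdd₂ β Z a b) (ha : a ≤ a') (hb : b' ≤ b) :
    HolderBdd₂ β Z a' b' := by
  obtain ⟨K, hK⟩ := h
  exact ⟨K, fun s t hs hst ht => hK s t (ha.trans hs) hst (ht.trans hb)⟩

lemma holderSemi₂_mono {a' b' : ℝ} (h : HolderBdd₂ β Z a b) (ha : a ≤ a') (hb : b' ≤ b) :
    holderSemi₂ β Z a' b' ≤ holderSemi₂ β Z a b :=
  holderSemi₂_le (holderSemi₂_nonneg _ _ _ _)
    fun _ _ hs hst ht => h.norm_le (ha.trans hs) hst (ht.trans hb)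

lemma HolderBdd₂.norm_le_sub {β' : ℝ} (h : HolderBdd₂ β' Z a b) {s t : ℝ} (hs : a ≤ s)
    (hst : s < t) (ht : t ≤ b) :
    ‖Z s t‖ ≤ holderSemi₂ β' Z a b * (t - s) ^ (β' - β) * (t - s) ^ β := by
  refine (h.norm_le hs hst ht).trans_eq ?_
  rw [mul_assoc, ← Real.rpow_add (sub_pos.2 hst)]
  ring_nf

lemma HolderBdd₂.of_le {β' : ℝ} (h : HolderBdd₂ β' Z a b) (hβ : β ≤ β') :
    HolderBdd₂ β Z a b := by
  refine ⟨holderSemi₂ β' Z a b * (b - a) ^ (β' - β), fun s t hs hst ht => ?_⟩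
  refine (h.norm_le_sub (β := β) hs hst ht).trans ?_
  have := sub_pos.2 hst
  have := holderSemi₂_nonneg β' Z a b
  gcongr

lemma HolderBdd₂.comp_le {F : Type*} [NormedAddCommGroup F] {W : ℝ → ℝ → F} {c : ℝ}
    (hc : 0 ≤ c) (h : HolderBdd₂ β Z a b)
    (hW : ∀ s t, a ≤ s → s < t → t ≤ b → ‖W s t‖ ≤ c * ‖Z s t‖) : HolderBdd₂ β W a b := by
  obtain ⟨K, hK⟩ := h
  refine ⟨c * K, fun s t hs hst ht => (hW s t hs hst ht).trans ?_⟩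
  rw [mul_assoc]
  exact mul_le_mul_of_nonneg_left (hK s t hs hst ht) hc

lemma holderSemi₂_comp_le {F : Type*} [NormedAddCommGroup F] {W : ℝ → ℝ → F} {c : ℝ}
    (hc : 0 ≤ c) (h : HolderBdd₂ β Z a b)
    (hW : ∀ s t, a ≤ s → s < t → t ≤ b → ‖W s t‖ ≤ c * ‖Z s t‖) :
    holderSemi₂ β W a b ≤ c * holderSemi₂ β Z a b := by
  refine holderSemi₂_le (mul_nonneg hc (holderSemi₂_nonneg _ _ _ _)) fun s t hs hst ht =>
    (hW s t hs hst ht).trans ?_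
  rw [mul_assoc]
  exact mul_le_mul_of_nonneg_left (h.norm_le hs hst ht) hc

@[simp] lemma incr_self (z : ℝ → E) (s : ℝ) : incr z s s = 0 := sub_self _

lemma incr_add_incr (z : ℝ → E) (s u t : ℝ) : incr z s u + incr z u t = incr z s t := by
  simp [incr]

lemma HolderBdd₂.continuousOn {z : ℝ → E} (hβ : 0 < β) (h : HolderBdd₂ β (incr z) a b) :
    ContinuousOn z (Icc a b) := by
  intro t ht
  rw [ContinuousWithinAt, tendsto_iff_norm_sub_tendsto_zero]
  have key : ∀ s ∈ Icc a b, ‖z s - z t‖ ≤ holderSemi₂ β (incr z) a b * |s - t| ^ β := by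
    intro s hs
    rcases le_total s t with hst | hst
    · rw [abs_sub_comm, abs_of_nonneg (sub_nonneg.2 hst), norm_sub_rev]
      exact h.norm_le' hs.1 hst ht.2 (incr_self _ _)
    · rw [abs_of_nonneg (sub_nonneg.2 hst)]
      exact h.norm_le' ht.1 hst hs.2 (incr_self _ _)
  have lim : Tendsto (fun s => holderSemi₂ β (incr z) a b * |s - t| ^ β) (𝓝[Icc a b] t) (𝓝 0) := by
    have : Continuous fun s => holderSemi₂ β (incr z) a b * |s - t| ^ β := by
      refine continuous_const.mul (Continuous.rpow_const (by fun_prop) fun _ => Or.inr hβ.le)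
    have h2 := this.tendsto t
    simp only [sub_self, abs_zero, Real.zero_rpow hβ.ne', mul_zero] at h2
    exact h2.mono_left nhdsWithin_le_nhds
  refine squeeze_zero' (Eventually.of_forall fun _ => norm_nonneg _) ?_ lim
  filter_upwards [self_mem_nhdsWithin] with s hs using key s hs

lemma norm_le_supNorm {z : ℝ → E} (hz : ContinuousOn z (Icc a b)) {t : ℝ} (ht : t ∈ Icc a b) :
    ‖z t‖ ≤ supNorm z a b :=
  le_csSup (isCompact_Icc.image_of_continuousOn hz.norm).bddAbove ⟨t, ht, rfl⟩

end Holder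

/-! ### Matrix contractions and the linear map C -/

section Algebra

variable {ι : Type*} {d m : ℕ}

@[simp] lemma act_apply (z : EuclideanSpace ℝ (ι × Fin m)) (v : EuclideanSpace ℝ (Fin m)) (i : ι) :
    act z v i = ∑ j, z (i, j) * v j := rfl

@[simp] lemma act₂_apply (z' : EuclideanSpace ℝ ((Fin d × Fin m) × Fin m))
    (X : EuclideanSpace ℝ (Fin m × Fin m)) (i : Fin d) :
    act₂ z' X i = ∑ j, ∑ k, z' ((i, j), k) * X (j, k) := rfl

lemma act_sub_left (z w : EuclideanSpace ℝ (ι × Fin m)) (v : EuclideanSpace ℝ (Fin m)) :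
    act (z - w) v = act z v - act w v := by
  ext i; simp [sub_mul, Finset.sum_sub_distrib]

lemma act_add_right (z : EuclideanSpace ℝ (ι × Fin m)) (v w : EuclideanSpace ℝ (Fin m)) :
    act z (v + w) = act z v + act z w := by
  ext i; simp [mul_add, Finset.sum_add_distrib]

@[simp] lemma act_zero_right (z : EuclideanSpace ℝ (ι × Fin m)) : act z 0 = 0 := by
  ext i; simp

lemma act₂_sub_left (z w : EuclideanSpace ℝ ((Fin d × Fin m) × Fin m))
    (X : EuclideanSpace ℝ (Fin m × Fin m)) : act₂ (z - w) X = act₂ z X - act₂ w X := by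
  ext i; simp [sub_mul, Finset.sum_sub_distrib]

lemma norm_act_le [Fintype ι] (z : EuclideanSpace ℝ (ι × Fin m)) (v : EuclideanSpace ℝ (Fin m)) :
    ‖act z v‖ ≤ ‖z‖ * ‖v‖ := by
  refine (sq_le_sq₀ (norm_nonneg _) (by positivity)).1 ?_
  rw [mul_pow, EuclideanSpace.real_norm_sq_eq, EuclideanSpace.real_norm_sq_eq,
    EuclideanSpace.real_norm_sq_eq, Fintype.sum_prod_type, Finset.sum_mul]
  refine Finset.sum_le_sum fun i _ => ?_
  have := Finset.sum_mul_sq_le_sq_mul_sq Finset.univ (fun j => z (i, j)) fun j => v j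
  simpa only [act_apply] using this

lemma norm_act₂_le (z : EuclideanSpace ℝ ((Fin d × Fin m) × Fin m))
    (X : EuclideanSpace ℝ (Fin m × Fin m)) : ‖act₂ z X‖ ≤ ‖z‖ * ‖X‖ := by
  refine (sq_le_sq₀ (norm_nonneg _) (by positivity)).1 ?_
  rw [mul_pow, EuclideanSpace.real_norm_sq_eq, EuclideanSpace.real_norm_sq_eq,
    EuclideanSpace.real_norm_sq_eq, Fintype.sum_prod_type, Fintype.sum_prod_type, Finset.sum_mul]
  refine Finset.sum_le_sum fun i _ => ?_
  have := Finset.sum_mul_sq_le_sq_mul_sq (Finset.univ : Finset (Fin m × Fin m))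
    (fun q => z ((i, q.1), q.2)) (fun q => X q)
  simpa only [act₂_apply, Fintype.sum_prod_type] using this

variable (C : Fin m → Matrix (Fin d) (Fin d) ℝ)

@[simp] lemma diffusion_apply (y : EuclideanSpace ℝ (Fin d)) (p : Fin d × Fin m) :
    diffusion C y p = ∑ l, C p.2 p.1 l * y l := rfl

lemma diffusionDeriv_apply (w : EuclideanSpace ℝ (Fin d × Fin m)) (q : (Fin d × Fin m) × Fin m) :
    diffusionDeriv C w q = diffusion C (WithLp.toLp 2 fun l => w (l, q.2)) q.1 := rfl

lemma diffusionDeriv_sub (w w' : EuclideanSpace ℝ (Fin d × Fin m)) :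
    diffusionDeriv C (w - w') = diffusionDeriv C w - diffusionDeriv C w' := by
  ext q
  simp [diffusionDeriv_apply, mul_sub, Finset.sum_sub_distrib]

/-- The operator norm is applied to each column and the squares are summed, so Cy' costs only the
operator norm of C, the one that enters M. -/
lemma norm_diffusionDeriv_le (w : EuclideanSpace ℝ (Fin d × Fin m)) :
    ‖diffusionDeriv C w‖ ≤ ‖diffusion C‖ * ‖w‖ := by
  refine (sq_le_sq₀ (norm_nonneg _) (by positivity)).1 ?_
  rw [mul_pow, EuclideanSpace.real_norm_sq_eq, EuclideanSpace.real_norm_sq_eq,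
    Fintype.sum_prod_type_right, Fintype.sum_prod_type_right, Finset.mul_sum]
  refine Finset.sum_le_sum fun k _ => ?_
  have h := (diffusion C).le_opNorm (WithLp.toLp 2 fun l => w (l, k))
  have h2 := pow_le_pow_left₀ (norm_nonneg _) h 2
  rw [mul_pow, EuclideanSpace.real_norm_sq_eq, EuclideanSpace.real_norm_sq_eq] at h2
  exact h2

lemma act_diffusionDeriv (w : EuclideanSpace ℝ (Fin d × Fin m)) (v : EuclideanSpace ℝ (Fin m)) :
    act (diffusionDeriv C w) v = diffusion C (act w v) := by
  ext p
  simp only [act_apply, diffusionDeriv_apply, diffusion_apply, Finset.sum_mul, Finset.mul_sum]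
  rw [Finset.sum_comm]
  simp only [mul_assoc]

end Algebra

/-! ### Sewing of almost additive functions -/

section Sewing

lemma partition_le {p : ℕ → ℝ} {n : ℕ} (hp : ∀ i < n, p i ≤ p (i + 1)) {i j : ℕ} (hij : i ≤ j)
    (hj : j ≤ n) : p i ≤ p j := by
  induction j, hij using Nat.le_induction with
  | base => exact le_rfl
  | succ k hk ih => exact (ih (by omega)).trans (hp k (by omega))

lemma exists_partition_interval {p : ℕ → ℝ} {n : ℕ} {c : ℝ} (hn : 0 < n) (h0 : p 0 ≤ c)
    (h1 : c ≤ p n) : ∃ k < n, p k ≤ c ∧ c ≤ p (k + 1) := by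
  induction n with
  | zero => omega
  | succ n ih =>
    rcases le_total (p n) c with h | h
    · exact ⟨n, by omega, h, h1⟩
    · rcases Nat.eq_zero_or_pos n with rfl | hn'
      · exact ⟨0, by omega, h0, h1⟩
      · obtain ⟨k, hk, hk'⟩ := ih hn' h
        exact ⟨k, by omega, hk'⟩

/-- The constant in the estimate of Riemann sums of an almost additive function. -/
def sewingConst (ζ : ℝ) : ℝ := 2 / (1 - 2 ^ (1 - ζ))

lemma two_rpow_one_sub_lt_one {ζ : ℝ} (hζ : 1 < ζ) : (2 : ℝ) ^ (1 - ζ) < 1 :=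
  Real.rpow_lt_one_of_one_lt_of_neg one_lt_two (by linarith)

lemma one_lt_sewingConst {ζ : ℝ} (hζ : 1 < ζ) : 1 < sewingConst ζ := by
  have h1 := two_rpow_one_sub_lt_one hζ
  have h2 : (0 : ℝ) < 2 ^ (1 - ζ) := by positivity
  rw [sewingConst, lt_div_iff₀ (by linarith)]
  linarith

/-- The constant is the fixed point of the recursion below: two halves of length L/2 and two defects
of size L^ζ reproduce the bound for L. A solution exists because 2^(1-ζ) < 1. -/
lemma two_mul_sewingConst {ζ L : ℝ} (hζ : 1 < ζ) (hL : 0 ≤ L) :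
    2 * sewingConst ζ * (L / 2) ^ ζ + 2 * L ^ ζ = sewingConst ζ * L ^ ζ := by
  have h1 := two_rpow_one_sub_lt_one hζ
  have h3 : (2 : ℝ) ^ (1 - ζ) = 2 / 2 ^ ζ := by
    rw [Real.rpow_sub two_pos, Real.rpow_one]
  have h4 : sewingConst ζ * (1 - 2 ^ (1 - ζ)) = 2 := by
    rw [sewingConst, div_mul_cancel₀]; linarith
  rw [h3] at h4
  rw [Real.div_rpow hL two_pos.le]
  linear_combination L ^ ζ * (-h4)

variable {E : Type*} [NormedAddCommGroup E] {Ξ : ℝ → ℝ → E} {a b K ζ : ℝ}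

/-- Bisection: removing the partition interval that contains the midpoint leaves two partitions,
each of at most half the length. Joining them again costs two defects of `Ξ`. The bound is
independent of the number of points. -/
lemma norm_partition_sum_sub_le (hK : 0 ≤ K) (hζ : 1 < ζ)
    (hΞ : ∀ s u t, a ≤ s → s ≤ u → u ≤ t → t ≤ b → ‖Ξ s t - Ξ s u - Ξ u t‖ ≤ K * (t - s) ^ ζ)
    (n : ℕ) (p : ℕ → ℝ) (h0 : a ≤ p 0) (hn : p n ≤ b) (hp : ∀ i < n, p i ≤ p (i + 1)) :
    ‖∑ i ∈ Finset.range n, Ξ (p i) (p (i + 1)) - Ξ (p 0) (p n)‖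
      ≤ sewingConst ζ * K * (p n - p 0) ^ ζ := by
  have hC := one_lt_sewingConst hζ
  induction n using Nat.strong_induction_on generalizing p with
  | _ n ih =>
  rcases Nat.eq_zero_or_pos n with rfl | hpos
  -- The degenerate triple forces `Ξ` to vanish on the diagonal.
  · have := hΞ (p 0) (p 0) (p 0) h0 le_rfl le_rfl hn
    simp only [sub_self, Real.zero_rpow (by linarith : ζ ≠ 0), mul_zero, zero_sub] at this ⊢
    simpa using this
  · have h0n := partition_le hp (Nat.zero_le n) le_rfl
    obtain ⟨k, hk, hk1, hk2⟩ := exists_partition_interval (p := p) (c := (p 0 + p n) / 2) hpos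
      (by linarith) (by linarith)
    obtain ⟨r, rfl⟩ : ∃ r, n = k + 1 + r := ⟨n - (k + 1), by omega⟩
    have h0k := partition_le hp (Nat.zero_le k) (by omega)
    have hkk := hp k (by omega)
    have hkn := partition_le hp (Nat.le_add_right (k + 1) r) le_rfl
    have i1 := ih k (by omega) p h0 (by linarith) (fun i hi => hp i (by omega))
    have i2 := ih r (by omega) (fun i => p (k + 1 + i)) (by simp; linarith) hn
      (fun i hi => hp _ (by omega))
    simp only [add_zero] at i2
    have e1 := hΞ (p 0) (p k) (p (k + 1 + r)) h0 h0k (hkk.trans hkn) hn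
    have e2 := hΞ (p k) (p (k + 1)) (p (k + 1 + r)) (h0.trans h0k) hkk hkn hn
    set L := p (k + 1 + r) - p 0 with hL
    have hL0 : 0 ≤ L := by linarith
    have b1 : sewingConst ζ * K * (p k - p 0) ^ ζ ≤ sewingConst ζ * K * (L / 2) ^ ζ := by
      gcongr
      linarith
    have b2 : sewingConst ζ * K * (p (k + 1 + r) - p (k + 1)) ^ ζ
        ≤ sewingConst ζ * K * (L / 2) ^ ζ := by
      gcongr
      linarith
    have b3 : K * (p (k + 1 + r) - p k) ^ ζ ≤ K * L ^ ζ := by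
      gcongr
      · linarith
      · linarith
    have split : ∑ i ∈ Finset.range (k + 1 + r), Ξ (p i) (p (i + 1)) - Ξ (p 0) (p (k + 1 + r))
        = (∑ i ∈ Finset.range k, Ξ (p i) (p (i + 1)) - Ξ (p 0) (p k))
          + (∑ i ∈ Finset.range r, Ξ (p (k + 1 + i)) (p (k + 1 + (i + 1)))
              - Ξ (p (k + 1)) (p (k + 1 + r)))
          - (Ξ (p 0) (p (k + 1 + r)) - Ξ (p 0) (p k) - Ξ (p k) (p (k + 1 + r)))
          - (Ξ (p k) (p (k + 1 + r)) - Ξ (p k) (p (k + 1)) - Ξ (p (k + 1)) (p (k + 1 + r))) := by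
      rw [Finset.sum_range_add, Finset.sum_range_succ]
      simp only [add_assoc]
      abel
    rw [split]
    have key := two_mul_sewingConst hζ hL0
    refine (norm_sub_le_of_le (norm_sub_le_of_le (norm_add_le_of_le i1 i2) e1) e2).trans ?_
    calc _ ≤ K * (2 * sewingConst ζ * (L / 2) ^ ζ + 2 * L ^ ζ) := by linarith
      _ = _ := by rw [key]; ring

/-- The Riemann sum of `Ξ` over the grid of step `h` based at `a`, stopped at `t`. -/
def gridSum (Ξ : ℝ → ℝ → E) (a h t : ℝ) : E :=
  ∑ k ∈ Finset.range ⌊(t - a) / h⌋₊, Ξ (a + k * h) (a + (k + 1 : ℕ) * h)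
    + Ξ (a + ⌊(t - a) / h⌋₊ * h) t

/-- The difference of two grid sums is a sum over a partition starting at the last grid point before
`s`. Moving that start to `s` costs one more defect, hence the `+ 1` and the extra length `h`. -/
lemma norm_gridSum_sub_le (hK : 0 ≤ K) (hζ : 1 < ζ)
    (hΞ : ∀ s u t, a ≤ s → s ≤ u → u ≤ t → t ≤ b → ‖Ξ s t - Ξ s u - Ξ u t‖ ≤ K * (t - s) ^ ζ)
    {h s t : ℝ} (hh : 0 < h) (hs : a ≤ s) (hst : s ≤ t) (ht : t ≤ b) :
    ‖gridSum Ξ a h t - gridSum Ξ a h s - Ξ s t‖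
      ≤ (sewingConst ζ + 1) * K * (t - s + h) ^ ζ := by
  have hC := one_lt_sewingConst hζ
  set i := ⌊(s - a) / h⌋₊ with hi
  set j := ⌊(t - a) / h⌋₊ with hj
  have hij : i ≤ j := Nat.floor_mono (by gcongr)
  obtain ⟨r, hr⟩ : ∃ r, j = i + r := ⟨j - i, by omega⟩
  have hih : i * h ≤ s - a := by
    rw [← le_div_iff₀ hh]; exact Nat.floor_le (div_nonneg (by linarith) hh.le)
  have hih' : s - a < (i + 1) * h := by
    rw [← div_lt_iff₀ hh]; exact Nat.lt_floor_add_one _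
  have hjh : j * h ≤ t - a := by
    rw [← le_div_iff₀ hh]; exact Nat.floor_le (div_nonneg (by linarith) hh.le)
  have hi0 : 0 ≤ i * h := by positivity
  let p : ℕ → ℝ := fun k => if k ≤ r then a + (i + k : ℕ) * h else t
  have hp0 : p 0 = a + i * h := by simp [p]
  have hp1 : p (r + 1) = t := by simp [p]
  have hpr : p r = a + j * h := by simp [p, hr]
  have hp : ∀ k < r + 1, p k ≤ p (k + 1) := by
    intro k hk
    rcases (Nat.lt_succ_iff.1 hk).eq_or_lt with rfl | hk'
    · rw [hp1, hpr]; linarith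
    · simp only [p, if_pos hk'.le, if_pos (Nat.succ_le_of_lt hk')]
      push_cast; nlinarith
  have main := norm_partition_sum_sub_le hK hζ hΞ (r + 1) p (by rw [hp0]; linarith)
    (by rw [hp1]; exact ht) hp
  have e := hΞ (a + i * h) s t (by linarith) (by linarith) hst ht
  have hsum : ∑ k ∈ Finset.range (r + 1), Ξ (p k) (p (k + 1))
      = ∑ k ∈ Finset.range r, Ξ (a + (i + k : ℕ) * h) (a + (i + k + 1 : ℕ) * h)
        + Ξ (a + j * h) t := by
    rw [Finset.sum_range_succ, hp1, hpr]
    congr 1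
    refine Finset.sum_congr rfl fun k hk => ?_
    have hk := Finset.mem_range.1 hk
    simp only [p, if_pos hk.le, if_pos (Nat.succ_le_of_lt hk), add_assoc]
  have split : gridSum Ξ a h t - gridSum Ξ a h s - Ξ s t
      = (∑ k ∈ Finset.range (r + 1), Ξ (p k) (p (k + 1)) - Ξ (p 0) (p (r + 1)))
        + (Ξ (a + i * h) t - Ξ (a + i * h) s - Ξ s t) := by
    rw [hsum, hp0, hp1, gridSum, gridSum, ← hi, ← hj, hr, Finset.sum_range_add]
    abel
  rw [split]
  rw [hp0, hp1] at main
  have hle : t - (a + i * h) ≤ t - s + h := by linarith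
  have hge : 0 ≤ t - (a + i * h) := by linarith
  rw [hp0, hp1]
  refine (norm_add_le_of_le main e).trans ?_
  have h0 : (0 : ℝ) ≤ sewingConst ζ + 1 := by linarith
  calc _ = (sewingConst ζ + 1) * K * (t - (a + i * h)) ^ ζ := by ring
    _ ≤ _ := by gcongr

/-- Sewing lemma: an almost additive function is close to the increments of a path. -/
lemma exists_sewing [ProperSpace E] (hK : 0 ≤ K) (hζ : 1 < ζ)
    (hΞ : ∀ s u t, a ≤ s → s ≤ u → u ≤ t → t ≤ b → ‖Ξ s t - Ξ s u - Ξ u t‖ ≤ K * (t - s) ^ ζ) :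
    ∃ F : ℝ → E, ∀ s t, a ≤ s → s ≤ t → t ≤ b →
      ‖F t - F s - Ξ s t‖ ≤ (sewingConst ζ + 1) * K * (t - s) ^ ζ := by
  have hC := one_lt_sewingConst hζ
  let h : ℕ → ℝ := fun n => 1 / ((n : ℝ) + 1)
  have hh : ∀ n, 0 < h n := fun n => by positivity
  have hh1 : ∀ n, h n ≤ 1 := fun n => by
    simp only [h]; rw [div_le_one (by positivity)]; linarith [(Nat.cast_nonneg n : (0 : ℝ) ≤ n)]
  have hlim : Tendsto h atTop (𝓝 0) := tendsto_one_div_add_atTop_nhds_zero_nat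
  -- The grid sums are bounded, so compactness gives a limit along an ultrafilter at every `t`
  -- simultaneously. Convergence in the ordinary sense is not needed here; `tendsto_partition_sum`
  -- supplies it afterwards.
  let U : Ultrafilter ℕ := Ultrafilter.of atTop
  have hU : (U : Filter ℕ) ≤ atTop := Ultrafilter.of_le atTop
  have hbdd : ∀ t, a ≤ t → t ≤ b → ∃ y, Tendsto (fun n => gridSum Ξ a (h n) t) U (𝓝 y) := by
    intro t ha hb
    have hball : ∀ n, gridSum Ξ a (h n) t ∈ Metric.closedBall (0 : E)
        ((sewingConst ζ + 1) * K * (t - a + 1) ^ ζ + ‖Ξ a a‖ + ‖Ξ a t‖) := by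
      intro n
      have h1 := norm_gridSum_sub_le hK hζ hΞ (hh n) le_rfl ha hb
      have h2 : gridSum Ξ a (h n) a = Ξ a a := by simp [gridSum]
      rw [mem_closedBall_zero_iff]
      have h3 : (sewingConst ζ + 1) * K * (t - a + h n) ^ ζ
          ≤ (sewingConst ζ + 1) * K * (t - a + 1) ^ ζ := by
        have : (0 : ℝ) ≤ sewingConst ζ + 1 := by linarith
        have := hh n
        have := hh1 n
        gcongr
      rw [h2] at h1
      calc ‖gridSum Ξ a (h n) t‖ = ‖(gridSum Ξ a (h n) t - Ξ a a - Ξ a t) + Ξ a a + Ξ a t‖ := by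
            congr 1; abel
        _ ≤ _ := norm_add_le_of_le (norm_add_le_of_le (h1.trans h3) le_rfl) le_rfl
    have := (isCompact_closedBall (0 : E) _).ultrafilter_le_nhds
      (U.map fun n => gridSum Ξ a (h n) t)
      (le_principal_iff.2 (Ultrafilter.mem_map.2 (univ_mem' hball)))
    obtain ⟨y, -, hy⟩ := this
    exact ⟨y, hy⟩
  classical
  refine ⟨fun t => if ht : a ≤ t ∧ t ≤ b then (hbdd t ht.1 ht.2).choose else 0, ?_⟩
  intro s t hs hst ht
  have hs' : a ≤ s ∧ s ≤ b := ⟨hs, hst.trans ht⟩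
  have ht' : a ≤ t ∧ t ≤ b := ⟨hs.trans hst, ht⟩
  simp only [dif_pos hs', dif_pos ht']
  have l1 := (hbdd s hs'.1 hs'.2).choose_spec
  have l2 := (hbdd t ht'.1 ht'.2).choose_spec
  have l3 := ((l2.sub l1).sub_const (Ξ s t)).norm
  have l4 : Tendsto (fun n => (sewingConst ζ + 1) * K * (t - s + h n) ^ ζ) U
      (𝓝 ((sewingConst ζ + 1) * K * (t - s) ^ ζ)) := by
    have h5 : Tendsto (fun n => t - s + h n) U (𝓝 (t - s)) := by
      simpa using (hlim.mono_left hU).const_add (t - s)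
    exact (h5.rpow_const (Or.inr (by linarith))).const_mul _
  exact le_of_tendsto_of_tendsto' l3 l4 fun n => norm_gridSum_sub_le hK hζ hΞ (hh n) hs hst ht

/-- Increments of `F` telescope, and on an interval shorter than δ the error is at most K'δ^(ζ-1)
times its length. The lengths add up to b - a, and ζ > 1 makes the total vanish with δ. -/
lemma tendsto_partition_sum {F : ℝ → E} {K' : ℝ} (hK : 0 ≤ K') (hζ : 1 < ζ)
    (hF : ∀ s t, a ≤ s → s ≤ t → t ≤ b → ‖F t - F s - Ξ s t‖ ≤ K' * (t - s) ^ ζ)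
    {ε : ℝ} (hε : 0 < ε) :
    ∃ δ > 0, ∀ (n : ℕ) (p : ℕ → ℝ), p 0 = a → p n = b →
      (∀ i < n, p i ≤ p (i + 1) ∧ p (i + 1) - p i < δ) →
      ‖(∑ i ∈ Finset.range n, Ξ (p i) (p (i + 1))) - (F b - F a)‖ < ε := by
  have lim : Tendsto (fun δ : ℝ => K' * δ ^ (ζ - 1) * (b - a)) (𝓝[>] 0) (𝓝 0) := by
    have : Continuous fun δ : ℝ => K' * δ ^ (ζ - 1) * (b - a) :=
      (continuous_const.mul (continuous_id.rpow_const fun _ => Or.inr (by linarith))).mul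
        continuous_const
    have h2 := this.tendsto 0
    rw [Real.zero_rpow (by linarith), mul_zero, zero_mul] at h2
    exact h2.mono_left nhdsWithin_le_nhds
  obtain ⟨δ, hδε, hδ : 0 < δ⟩ := ((lim.eventually (gt_mem_nhds hε)).and self_mem_nhdsWithin).exists
  refine ⟨δ, hδ, fun n p h0 hn hp => lt_of_le_of_lt ?_ hδε⟩
  have tel : F b - F a = ∑ i ∈ Finset.range n, (F (p (i + 1)) - F (p i)) := by
    rw [Finset.sum_range_sub (fun i => F (p i)), h0, hn]
  have tel' : b - a = ∑ i ∈ Finset.range n, (p (i + 1) - p i) := by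
    rw [Finset.sum_range_sub, h0, hn]
  rw [tel, tel', ← Finset.sum_sub_distrib, Finset.mul_sum]
  refine norm_sum_le_of_le _ fun i hi => ?_
  have hi := Finset.mem_range.1 hi
  have hm : ∀ i < n, p i ≤ p (i + 1) := fun i hi => (hp i hi).1
  have l1 := partition_le hm (Nat.zero_le i) hi.le
  have l2 := partition_le hm (Nat.succ_le_of_lt hi) le_rfl
  obtain ⟨l3, l4⟩ := hp i hi
  rw [norm_sub_rev]
  refine (hF _ _ (by linarith) l3 (by linarith)).trans ?_
  have l5 : 0 ≤ p (i + 1) - p i := by linarith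
  calc K' * (p (i + 1) - p i) ^ ζ
      = K' * (p (i + 1) - p i) ^ (ζ - 1) * (p (i + 1) - p i) := by
        rw [mul_assoc, ← Real.rpow_add_one' l5 (by linarith), sub_add_cancel]
    _ ≤ _ := by
        gcongr

end Sewing

/-! ### Existence and additivity of rough integrals -/

section RoughIntegral

variable {d m : ℕ} {α a b : ℝ} {x : ℝ → EuclideanSpace ℝ (Fin m)}
  {X : ℝ → ℝ → EuclideanSpace ℝ (Fin m × Fin m)} {z : ℝ → EuclideanSpace ℝ (Fin d × Fin m)}
  {z' : ℝ → EuclideanSpace ℝ ((Fin d × Fin m) × Fin m)}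

lemma IsRoughPath.self_eq_zero (hx : IsRoughPath α x X a b) {s : ℝ} (h1 : a ≤ s) (h2 : s ≤ b) :
    X s s = 0 := by
  ext ⟨j, k⟩
  have := hx.chen s s s h1 le_rfl le_rfl h2 j k
  simpa using this

lemma IsRoughPath.mono (hx : IsRoughPath α x X a b) {a' b' : ℝ} (ha : a ≤ a') (hb : b' ≤ b) :
    IsRoughPath α x X a' b' :=
  ⟨hx.holder.mono ha hb, hx.holder₂.mono ha hb,
    fun s u t h1 h2 h3 h4 => hx.chen s u t (ha.trans h1) h2 h3 (h4.trans hb)⟩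

lemma IsRoughPath.of_le {β : ℝ} (hx : IsRoughPath β x X a b) (h : α ≤ β) :
    IsRoughPath α x X a b :=
  ⟨hx.holder.of_le h, hx.holder₂.of_le (by linarith), hx.chen⟩

lemma IsControlled.mono {ι : Type*} [Fintype ι] {z : ℝ → EuclideanSpace ℝ ι}
    {z' : ℝ → EuclideanSpace ℝ (ι × Fin m)} (hz : IsControlled α x z z' a b) {a' b' : ℝ}
    (ha : a ≤ a') (hb : b' ≤ b) : IsControlled α x z z' a' b' :=
  ⟨hz.path.mono ha hb, hz.deriv.mono ha hb, hz.rem.mono ha hb⟩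

@[simp] lemma remainder_self {ι : Type*} [Fintype ι] (x : ℝ → EuclideanSpace ℝ (Fin m))
    (z : ℝ → EuclideanSpace ℝ ι) (z' : ℝ → EuclideanSpace ℝ (ι × Fin m)) (s : ℝ) :
    remainder x z z' s s = 0 := by
  simp [remainder]

/-- Chen's relation turns the defect of the z'X term into (z'_s x_{s,u})x_{u,t}, which completes the
increment of z to its remainder. Both surviving terms have order 3α. -/
lemma germ_sub_sub (hx : IsRoughPath α x X a b) {s u t : ℝ} (h1 : a ≤ s) (h2 : s ≤ u)
    (h3 : u ≤ t) (h4 : t ≤ b) :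
    germ x X z z' s t - germ x X z z' s u - germ x X z z' u t
      = -(act (remainder x z z' s u) (incr x u t) + act₂ (incr z' s u) (X u t)) := by
  have hX : ∀ j k, X s t (j, k) = X s u (j, k) + X u t (j, k) + incr x u t j * incr x s u k :=
    fun j k => by linarith [hx.chen s u t h1 h2 h3 h4 j k]
  have hact : act₂ (z' s) (X s t) = act₂ (z' s) (X s u) + act₂ (z' s) (X u t)
      + act (act (z' s) (incr x s u)) (incr x u t) := by
    ext i
    simp only [act₂_apply, hX, act_apply, PiLp.add_apply, mul_add, Finset.sum_add_distrib,
      Finset.sum_mul]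
    congr 1
    refine Finset.sum_congr rfl fun j _ => Finset.sum_congr rfl fun k _ => ?_
    ring
  have e : act (z s) (incr x s t) = act (z s) (incr x s u) + act (z s) (incr x u t) := by
    rw [← act_add_right, incr_add_incr]
  rw [germ, germ, germ, hact, e, remainder, act_sub_left]
  simp only [incr, act_sub_left, act₂_sub_left]
  abel

lemma norm_germ_sub_sub_le (hα : 0 < α) (hx : IsRoughPath α x X a b)
    (hz : IsControlled α x z z' a b) {s u t : ℝ} (h1 : a ≤ s) (h2 : s ≤ u)
    (h3 : u ≤ t) (h4 : t ≤ b) :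
    ‖germ x X z z' s t - germ x X z z' s u - germ x X z z' u t‖
      ≤ (holderSemi₂ α (incr x) a b * holderSemi₂ (2 * α) (remainder x z z') a b
            + holderSemi₂ α (incr z') a b * holderSemi₂ (2 * α) X a b) * (t - s) ^ (3 * α) := by
  rw [germ_sub_sub hx h1 h2 h3 h4, norm_neg, add_mul]
  have n1 := holderSemi₂_nonneg α (incr x) a b
  have n2 := holderSemi₂_nonneg (2 * α) (remainder x z z') a b
  have n3 := holderSemi₂_nonneg α (incr z') a b
  have n4 := holderSemi₂_nonneg (2 * α) X a b
  have e1 := hz.rem.norm_le' h1 h2 (h3.trans h4) (remainder_self _ _ _ _)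
  have e2 := hx.holder.norm_le' (h1.trans h2) h3 h4 (incr_self _ _)
  have e3 := hz.deriv.norm_le' h1 h2 (h3.trans h4) (incr_self _ _)
  have e4 := hx.holder₂.norm_le' (h1.trans h2) h3 h4 (hx.self_eq_zero (h1.trans h2) (h3.trans h4))
  have p0 : 0 ≤ t - s := by linarith
  have p1 : 0 ≤ u - s := by linarith
  have p2 : 0 ≤ t - u := by linarith
  have r1 : (u - s) ^ (2 * α) ≤ (t - s) ^ (2 * α) := by gcongr
  have r2 : (t - u) ^ α ≤ (t - s) ^ α := by gcongr
  have r3 : (u - s) ^ α ≤ (t - s) ^ α := by gcongr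
  have r4 : (t - u) ^ (2 * α) ≤ (t - s) ^ (2 * α) := by gcongr
  have r5 : (t - s) ^ (3 * α) = (t - s) ^ α * (t - s) ^ (2 * α) := by
    rw [← Real.rpow_add_of_nonneg p0 (by linarith) (by linarith)]; ring_nf
  refine norm_add_le_of_le ((norm_act_le _ _).trans ?_) ((norm_act₂_le _ _).trans ?_)
  · calc _ ≤ (holderSemi₂ (2 * α) (remainder x z z') a b * (t - s) ^ (2 * α))
          * (holderSemi₂ α (incr x) a b * (t - s) ^ α) :=
        mul_le_mul (e1.trans (by gcongr)) (e2.trans (by gcongr)) (norm_nonneg _) (by positivity)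
      _ = _ := by rw [r5]; ring
  · calc _ ≤ (holderSemi₂ α (incr z') a b * (t - s) ^ α)
          * (holderSemi₂ (2 * α) X a b * (t - s) ^ (2 * α)) :=
        mul_le_mul (e3.trans (by gcongr)) (e4.trans (by gcongr)) (norm_nonneg _) (by positivity)
      _ = _ := by rw [r5]; ring

lemma isRoughConst_sewingConst (hα : 1 / 3 < α) :
    IsRoughConst α (sewingConst (3 * α) + 1) := by
  have hζ : 1 < 3 * α := by linarith
  have hC := one_lt_sewingConst hζ
  refine ⟨by linarith, ?_⟩
  intro d m a b _ _ x X hx z z' hz s t hs hst ht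
  have hx' := hx.mono hs ht
  have hz' := hz.mono hs ht
  set K := holderSemi₂ α (incr x) s t * holderSemi₂ (2 * α) (remainder x z z') s t
            + holderSemi₂ α (incr z') s t * holderSemi₂ (2 * α) X s t with hKdef
  have hK : 0 ≤ K := by
    have n1 := holderSemi₂_nonneg α (incr x) s t
    have n2 := holderSemi₂_nonneg (2 * α) (remainder x z z') s t
    have n3 := holderSemi₂_nonneg α (incr z') s t
    have n4 := holderSemi₂_nonneg (2 * α) X s t
    positivity
  obtain ⟨F, hF⟩ := exists_sewing (Ξ := germ x X z z') hK hζ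
    fun u v w h1 h2 h3 h4 => norm_germ_sub_sub_le (by linarith) hx' hz' h1 h2 h3 h4
  refine ⟨F t - F s, fun ε hε => tendsto_partition_sum (by positivity) hζ hF hε, ?_⟩
  refine (hF s t le_rfl hst le_rfl).trans_eq ?_
  ring

lemma exists_fine_partition {s t δ : ℝ} (hst : s ≤ t) (hδ : 0 < δ) :
    ∃ (n : ℕ) (p : ℕ → ℝ), p 0 = s ∧ p n = t ∧
      ∀ i < n, p i ≤ p (i + 1) ∧ p (i + 1) - p i < δ := by
  obtain ⟨n, hn⟩ := exists_nat_gt ((t - s) / δ)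
  have hn0 : (0 : ℝ) < n := lt_of_le_of_lt (div_nonneg (by linarith) hδ.le) hn
  have step : (t - s) / n < δ := by
    rw [div_lt_iff₀ hδ] at hn
    rw [div_lt_iff₀ hn0]; linarith
  refine ⟨n, fun i => s + i * ((t - s) / n), by simp, by field_simp; ring, fun i _ => ?_⟩
  have : 0 ≤ (t - s) / n := div_nonneg (by linarith) hn0.le
  push_cast
  constructor <;> linarith

/-- Fine partitions of [s,u] and [u,t] concatenate to one of [s,t], and their Riemann sums add. The
equation of a solution speaks only of integrals from `a`; this localises it. -/
lemma IsRoughIntegral.eq_sub {s u t : ℝ} (hsu : s ≤ u) (hut : u ≤ t)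
    {J J₁ J₂ : EuclideanSpace ℝ (Fin d)} (h₁ : IsRoughIntegral x X z z' s u J₁)
    (h₂ : IsRoughIntegral x X z z' s t J₂) (h : IsRoughIntegral x X z z' u t J) :
    J = J₂ - J₁ := by
  rw [← sub_eq_zero, ← norm_le_zero_iff]
  refine le_of_forall_pos_le_add fun ε hε => ?_
  obtain ⟨δ, hδ, H⟩ := h (ε / 3) (by positivity)
  obtain ⟨δ₁, hδ₁, H₁⟩ := h₁ (ε / 3) (by positivity)
  obtain ⟨δ₂, hδ₂, H₂⟩ := h₂ (ε / 3) (by positivity)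
  obtain ⟨n, p, p0, pn, hp⟩ := exists_fine_partition hsu (lt_min hδ₁ hδ₂)
  obtain ⟨k, q, q0, qk, hq⟩ := exists_fine_partition hut (lt_min hδ hδ₂)
  let r : ℕ → ℝ := fun i => if i ≤ n then p i else q (i - n)
  have hr1 : ∀ i ≤ n, r i = p i := fun i hi => by simp [r, hi]
  have hr2 : ∀ i, r (n + i) = q i := fun i => by
    rcases Nat.eq_zero_or_pos i with rfl | hi
    · simp [r, pn, q0]
    · simp [r, hi.ne']
  have E := H k q q0 qk fun i hi => ⟨(hq i hi).1, (hq i hi).2.trans_le (min_le_left _ _)⟩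
  have E₁ := H₁ n p p0 pn fun i hi => ⟨(hp i hi).1, (hp i hi).2.trans_le (min_le_left _ _)⟩
  have E₂ := H₂ (n + k) r (by rw [hr1 0 (by omega), p0]) (by rw [hr2, qk]) (by
    intro i hi
    rcases lt_or_ge i n with h | h
    · rw [hr1 i h.le, hr1 (i + 1) h]
      exact ⟨(hp i h).1, (hp i h).2.trans_le (min_le_right _ _)⟩
    · obtain ⟨l, rfl⟩ := Nat.exists_eq_add_of_le h
      rw [add_assoc, hr2, hr2]
      exact ⟨(hq l (by omega)).1, (hq l (by omega)).2.trans_le (min_le_right _ _)⟩)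
  have sum_eq : ∑ i ∈ Finset.range (n + k), germ x X z z' (r i) (r (i + 1))
      = ∑ i ∈ Finset.range n, germ x X z z' (p i) (p (i + 1))
        + ∑ i ∈ Finset.range k, germ x X z z' (q i) (q (i + 1)) := by
    rw [Finset.sum_range_add]
    congr 1
    · refine Finset.sum_congr rfl fun i hi => ?_
      have hi := Finset.mem_range.1 hi
      rw [hr1 i hi.le, hr1 (i + 1) hi]
    · refine Finset.sum_congr rfl fun i _ => ?_
      rw [add_assoc, hr2, hr2]
  rw [sum_eq] at E₂
  set S := ∑ i ∈ Finset.range n, germ x X z z' (p i) (p (i + 1))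
  set T := ∑ i ∈ Finset.range k, germ x X z z' (q i) (q (i + 1))
  have : J - (J₂ - J₁) = ((S + T) - J₂) - (S - J₁) - (T - J) := by abel
  rw [this]
  linarith [norm_sub_le_of_le (norm_sub_le_of_le E₂.le E₁.le) E.le]

end RoughIntegral

/-! ### Continuity of the control and finiteness of the greedy times -/

section Greedy

variable {E : Type*} [NormedAddCommGroup E] {Z : ℝ → ℝ → E} {β θ L s b : ℝ}

@[simp] lemma holderSemi₂_self (β : ℝ) (Z : ℝ → ℝ → E) (s : ℝ) : holderSemi₂ β Z s s = 0 :=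
  le_antisymm (holderSemi₂_le le_rfl fun _ _ h1 h2 h3 => by linarith) (holderSemi₂_nonneg _ _ _ _)

/-- A pair straddling t is cut at t; a pair beyond t is cut at its own left end, where Z vanishes.
Either way the part beyond t costs at most L(t'-t)^θ. -/
lemma HolderBdd₂.holderSemi₂_le_add (hβ : 0 ≤ β) (hθ : 0 ≤ θ) (hL : 0 ≤ L)
    (h : HolderBdd₂ β Z s b) (h0 : ∀ u, s ≤ u → u ≤ b → Z u u = 0)
    (hZ : ∀ u r v, s ≤ u → u ≤ r → r ≤ v → v ≤ b →
      ‖Z u v‖ ≤ ‖Z u r‖ + L * (v - r) ^ θ * (v - u) ^ β)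
    {t t' : ℝ} (htt' : t ≤ t') (ht' : t' ≤ b) :
    holderSemi₂ β Z s t' ≤ holderSemi₂ β Z s t + L * (t' - t) ^ θ := by
  have n1 := holderSemi₂_nonneg β Z s t
  have n2 : 0 ≤ (t' - t) ^ θ := Real.rpow_nonneg (by linarith) _
  refine holderSemi₂_le (by positivity) fun u v hu huv hv => ?_
  have n3 : 0 ≤ (v - u) ^ β := Real.rpow_nonneg (by linarith) _
  rw [add_mul]
  rcases le_total v t with hvt | htv
  · exact ((h.mono le_rfl (htt'.trans ht')).norm_le hu huv hvt).trans
      (le_add_of_nonneg_right (by positivity))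
  rcases le_total u t with hut | htu
  · refine (hZ u t v hu hut htv (hv.trans ht')).trans (add_le_add ?_ ?_)
    · refine ((h.mono le_rfl (htt'.trans ht')).norm_le' hu hut le_rfl
        (h0 u hu (by linarith))).trans ?_
      have : 0 ≤ t - u := by linarith
      gcongr
    · have : 0 ≤ v - t := by linarith
      gcongr
  · have := hZ u u v hu le_rfl huv.le (hv.trans ht')
    rw [h0 u hu (by linarith), norm_zero, zero_add] at this
    refine (this.trans ?_).trans (le_add_of_nonneg_left (by positivity))
    have : 0 ≤ v - u := by linarith
    gcongr

lemma HolderBdd₂.continuousOn_holderSemi₂ (hβ : 0 ≤ β) (hθ : 0 < θ) (hL : 0 ≤ L)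
    (h : HolderBdd₂ β Z s b) (h0 : ∀ u, s ≤ u → u ≤ b → Z u u = 0)
    (hZ : ∀ u r v, s ≤ u → u ≤ r → r ≤ v → v ≤ b →
      ‖Z u v‖ ≤ ‖Z u r‖ + L * (v - r) ^ θ * (v - u) ^ β) :
    ContinuousOn (holderSemi₂ β Z s) (Icc s b) := by
  refine HolderBdd₂.continuousOn (β := θ) hθ ⟨L, fun t t' ht htt' ht' => ?_⟩
  rw [incr, Real.norm_of_nonneg (sub_nonneg.2
    (holderSemi₂_mono (h.mono le_rfl ht') le_rfl htt'.le))]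
  linarith [h.holderSemi₂_le_add hβ hθ.le hL h0 hZ htt'.le ht']

variable {m : ℕ} {α ν γ a : ℝ} {x : ℝ → EuclideanSpace ℝ (Fin m)}
  {X : ℝ → ℝ → EuclideanSpace ℝ (Fin m × Fin m)}

lemma IsRoughPath.norm_le_chen (hx : IsRoughPath α x X a b) {s u t : ℝ} (h1 : a ≤ s)
    (h2 : s ≤ u) (h3 : u ≤ t) (h4 : t ≤ b) :
    ‖X s t‖ ≤ ‖X s u‖ + ‖X u t‖ + ‖incr x u t‖ * ‖incr x s u‖ := by
  let T : EuclideanSpace ℝ (Fin m × Fin m) :=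
    WithLp.toLp 2 fun q => incr x u t q.1 * incr x s u q.2
  have hX : X s t = X s u + X u t + T := by
    ext ⟨j, k⟩
    simp only [PiLp.add_apply, T]
    linarith [hx.chen s u t h1 h2 h3 h4 j k]
  have hT : ‖T‖ ≤ ‖incr x u t‖ * ‖incr x s u‖ := by
    refine (sq_le_sq₀ (norm_nonneg _) (by positivity)).1 (le_of_eq ?_)
    rw [mul_pow, EuclideanSpace.real_norm_sq_eq, EuclideanSpace.real_norm_sq_eq,
      EuclideanSpace.real_norm_sq_eq, Fintype.sum_prod_type, Finset.sum_mul_sum]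
    simp only [T, mul_pow]
  rw [hX]
  exact norm_add_le_of_le (norm_add_le _ _) hT

lemma rpow_le_rpow_sub_mul {u r v : ℝ} (hα : 0 ≤ α) (hαν : α ≤ ν) (h1 : u ≤ r) (h2 : r ≤ v) :
    (v - r) ^ ν ≤ (v - r) ^ (ν - α) * (v - u) ^ α := by
  have e : (v - r) ^ ν = (v - r) ^ (ν - α) * (v - r) ^ α := by
    rw [← Real.rpow_add_of_nonneg (by linarith) (by linarith) hα, sub_add_cancel]
  rw [e]
  have : 0 ≤ v - r := by linarith
  gcongr

/-- A ν-Hölder piece over [r,v] has α-quotient of order (v-r)^(ν-α), so moving the right endpoint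
changes the α-seminorm continuously. -/
lemma IsRoughPath.continuousOn_roughSemi (hα : 0 < α) (hαν : α < ν)
    (hx : IsRoughPath ν x X s b) : ContinuousOn (roughSemi α x X s) (Icc s b) := by
  have hx' := hx.of_le hαν.le
  set K := holderSemi₂ ν (incr x) s b with hK
  set K₂ := holderSemi₂ (2 * ν) X s b with hK₂
  have n1 : 0 ≤ K := holderSemi₂_nonneg _ _ _ _
  have n2 : 0 ≤ K₂ := holderSemi₂_nonneg _ _ _ _
  have hθ : 0 < ν - α := by linarith
  refine ContinuousOn.add ?_ (ContinuousOn.sqrt ?_)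
  · refine hx'.holder.continuousOn_holderSemi₂ hα.le hθ n1 (fun u _ _ => incr_self _ _) ?_
    intro u r v h1 h2 h3 h4
    rw [← incr_add_incr x u r v, mul_assoc]
    refine norm_add_le_of_le le_rfl ((hx.holder.norm_le' (h1.trans h2) h3 h4
      (incr_self _ _)).trans ?_)
    gcongr
    exact rpow_le_rpow_sub_mul hα.le hαν.le h2 h3
  · rcases lt_or_ge b s with hbs | hsb
    · rw [Icc_eq_empty (not_le.2 hbs)]; exact continuousOn_empty _
    have hB : 0 ≤ (b - s) ^ (ν - α) := Real.rpow_nonneg (by linarith) _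
    -- Both X_{r,v} and the Chen product carry two powers ν. One yields the gain (v-r)^(ν-α); the
    -- gain of the other is absorbed into the constant (b-s)^(ν-α).
    refine hx'.holder₂.continuousOn_holderSemi₂ (L := (K₂ + K * K) * (b - s) ^ (ν - α))
      (by linarith) hθ (by positivity) (fun u h1 h2 => hx.self_eq_zero h1 h2) ?_
    intro u r v h1 h2 h3 h4
    refine (hx.norm_le_chen h1 h2 h3 h4).trans ?_
    rw [add_assoc]
    refine add_le_add le_rfl ?_
    have b1 := hx.holder₂.norm_le' (h1.trans h2) h3 h4 (hx.self_eq_zero (h1.trans h2) (h3.trans h4))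
    have b2 := hx.holder.norm_le' (h1.trans h2) h3 h4 (incr_self _ _)
    have b3 := hx.holder.norm_le' h1 h2 (h3.trans h4) (incr_self _ _)
    have p1 : 0 ≤ v - r := by linarith
    have p2 : 0 ≤ r - u := by linarith
    have p3 : 0 ≤ v - u := by linarith
    have q1 : (v - r) ^ ν ≤ (v - r) ^ (ν - α) * (v - u) ^ α :=
      rpow_le_rpow_sub_mul hα.le hαν.le h2 h3
    have q2 : (v - r) ^ ν ≤ (b - s) ^ (ν - α) * (v - u) ^ α := by
      have : v - r ≤ b - s := by linarith
      refine q1.trans ?_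
      gcongr
    have q3 : (r - u) ^ ν ≤ (b - s) ^ (ν - α) * (v - u) ^ α := by
      have : r - u ≤ b - s := by linarith
      refine (rpow_le_rpow_sub_mul hα.le hαν.le le_rfl h2).trans ?_
      gcongr
    have e1 : (v - r) ^ (2 * ν) = (v - r) ^ ν * (v - r) ^ ν := by
      rw [← Real.rpow_add_of_nonneg p1 (by linarith) (by linarith), two_mul]
    have e2 : (v - u) ^ (2 * α) = (v - u) ^ α * (v - u) ^ α := by
      rw [← Real.rpow_add_of_nonneg p3 (by linarith) (by linarith), two_mul]
    have c1 : ‖X r v‖ ≤ K₂ * (((v - r) ^ (ν - α) * (v - u) ^ α)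
        * ((b - s) ^ (ν - α) * (v - u) ^ α)) := by
      refine b1.trans ?_
      rw [e1]
      gcongr
    have c2 : ‖incr x r v‖ * ‖incr x u r‖ ≤ (K * ((v - r) ^ (ν - α) * (v - u) ^ α))
        * (K * ((b - s) ^ (ν - α) * (v - u) ^ α)) := by
      refine mul_le_mul (b2.trans ?_) (b3.trans ?_) (norm_nonneg _) (by positivity)
      · gcongr
      · gcongr
    rw [e2]
    refine (add_le_add c1 c2).trans_eq ?_
    ring

lemma roughSemi_nonneg (α : ℝ) (x : ℝ → EuclideanSpace ℝ (Fin m))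
    (X : ℝ → ℝ → EuclideanSpace ℝ (Fin m × Fin m)) (a b : ℝ) : 0 ≤ roughSemi α x X a b :=
  add_nonneg (holderSemi₂_nonneg _ _ _ _) (Real.sqrt_nonneg _)

lemma holderSemi₂_le_rpow {ν α : ℝ} (hαν : α ≤ ν) (h : HolderBdd₂ ν Z a b) {s t : ℝ}
    (hs : a ≤ s) (hst : s ≤ t) (ht : t ≤ b) :
    holderSemi₂ α Z s t ≤ holderSemi₂ ν Z a b * (t - s) ^ (ν - α) := by
  have n1 := holderSemi₂_nonneg ν Z a b
  have n2 : 0 ≤ (t - s) ^ (ν - α) := Real.rpow_nonneg (by linarith) _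
  refine holderSemi₂_le (by positivity) fun u v hu huv hv => ?_
  refine (h.norm_le_sub (β := α) (hs.trans hu) huv (hv.trans ht)).trans ?_
  have : 0 ≤ v - u := by linarith
  gcongr

/-- The control whose level sets define the greedy times. -/
def greedyControl (α : ℝ) (x : ℝ → EuclideanSpace ℝ (Fin m))
    (X : ℝ → ℝ → EuclideanSpace ℝ (Fin m × Fin m)) (s t : ℝ) : ℝ :=
  (t - s) ^ (1 - 2 * α) + roughSemi α x X s t

lemma greedyControl_self (hα : α < 1 / 2) (s : ℝ) : greedyControl α x X s s = 0 := by
  simp [greedyControl, roughSemi, Real.zero_rpow (by linarith : 1 - 2 * α ≠ 0)]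

lemma IsRoughPath.continuousOn_greedyControl (hα : 0 < α) (hα' : α < 1 / 2) (hαν : α < ν)
    (hx : IsRoughPath ν x X s b) : ContinuousOn (greedyControl α x X s) (Icc s b) :=
  ContinuousOn.add (Continuous.continuousOn
    (Continuous.rpow_const (by fun_prop) fun _ => Or.inr (by linarith)))
    (hx.continuousOn_roughSemi hα hαν)

/-- The ν-seminorms on [a,b] give a modulus in t - s alone that vanishes at 0. Hence every greedy
step ending on the level γ has length at least δ. -/
lemma IsRoughPath.exists_greedyControl_lt (hα' : α < 1 / 2) (hαν : α < ν)
    (hx : IsRoughPath ν x X a b) (hγ : 0 < γ) :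
    ∃ δ > 0, ∀ s t, a ≤ s → s ≤ t → t ≤ b → t - s < δ → greedyControl α x X s t < γ := by
  let ω : ℝ → ℝ := fun r => r ^ (1 - 2 * α) + (holderSemi₂ ν (incr x) a b * r ^ (ν - α)
    + Real.sqrt (holderSemi₂ (2 * ν) X a b * r ^ (2 * ν - 2 * α)))
  have hω : Continuous ω := by
    refine (Real.continuous_rpow_const (by linarith)).add ((continuous_const.mul
      (Real.continuous_rpow_const (by linarith))).add (Real.continuous_sqrt.comp
      (continuous_const.mul (Real.continuous_rpow_const (by linarith)))))
  have h0 : ω 0 = 0 := by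
    simp [ω, Real.zero_rpow (by linarith : 1 - 2 * α ≠ 0),
      Real.zero_rpow (by linarith : ν - α ≠ 0), Real.zero_rpow (by linarith : 2 * ν - 2 * α ≠ 0)]
  have h1 := hω.tendsto 0
  rw [h0] at h1
  obtain ⟨δ, hδ, H⟩ := Metric.eventually_nhds_iff.1 (h1.eventually (gt_mem_nhds hγ))
  refine ⟨δ, hδ, fun s t hs hst ht hlt => lt_of_le_of_lt ?_ (H (y := t - s) ?_)⟩
  · refine add_le_add le_rfl (add_le_add ?_ (Real.sqrt_le_sqrt ?_))
    · exact holderSemi₂_le_rpow hαν.le hx.holder hs hst ht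
    · exact holderSemi₂_le_rpow (by linarith) hx.holder₂ hs hst ht
  · rwa [Real.dist_0_eq_abs, abs_of_nonneg (by linarith)]

lemma greedyTime_succ (γ α : ℝ) (x : ℝ → EuclideanSpace ℝ (Fin m))
    (X : ℝ → ℝ → EuclideanSpace ℝ (Fin m × Fin m)) (a b : ℝ) (i : ℕ) :
    greedyTime γ α x X a b (i + 1)
      = sInf ({t : ℝ | greedyTime γ α x X a b i < t ∧ t ≤ b ∧
        greedyControl α x X (greedyTime γ α x X a b i) t = γ} ∪ {b}) := rfl

/-- The control vanishes at `s` and γ > 0, so the strict `s < t` may be relaxed; the level set is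
then compact and the infimum is attained. -/
lemma IsRoughPath.sInf_greedy_mem (hα : 0 < α) (hα' : α < 1 / 2) (hαν : α < ν)
    (hx : IsRoughPath ν x X s b) (hγ : 0 < γ) :
    sInf ({t : ℝ | s < t ∧ t ≤ b ∧ greedyControl α x X s t = γ} ∪ {b})
      ∈ {t : ℝ | s < t ∧ t ≤ b ∧ greedyControl α x X s t = γ} ∪ {b} := by
  have hS : {t : ℝ | s < t ∧ t ≤ b ∧ greedyControl α x X s t = γ}
      = Icc s b ∩ greedyControl α x X s ⁻¹' {γ} := by
    ext t
    constructor
    · rintro ⟨h1, h2, h3⟩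
      exact ⟨⟨h1.le, h2⟩, h3⟩
    · rintro ⟨⟨h1, h2⟩, h3⟩
      refine ⟨lt_of_le_of_ne h1 ?_, h2, h3⟩
      rintro rfl
      rw [mem_preimage, greedyControl_self hα', mem_singleton_iff] at h3
      exact hγ.ne h3
  have hcl := (hx.continuousOn_greedyControl hα hα' hαν).preimage_isClosed_of_isClosed
    isClosed_Icc (isClosed_singleton (x := γ))
  rw [hS]
  exact ((isCompact_Icc.inter_left hcl |>.of_isClosed_subset hcl (by
    intro t ht; exact ⟨ht, ht.1⟩)).union isCompact_singleton).sInf_mem ⟨b, Or.inr rfl⟩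

lemma IsRoughPath.sInf_greedy_spec (hα : 0 < α) (hα' : α < 1 / 2) (hαν : α < ν)
    (hx : IsRoughPath ν x X s b) (hγ : 0 < γ) (hsb : s < b) {t : ℝ}
    (ht : t = sInf ({t : ℝ | s < t ∧ t ≤ b ∧ greedyControl α x X s t = γ} ∪ {b})) :
    s < t ∧ t ≤ b ∧ greedyControl α x X s t ≤ γ ∧ (t = b ∨ greedyControl α x X s t = γ) := by
  have hmem := hx.sInf_greedy_mem hα hα' hαν hγ
  rw [← ht] at hmem
  rcases hmem with ⟨h1, h2, h3⟩ | h
  · exact ⟨h1, h2, h3.le, Or.inr h3⟩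
  · have htb : t = b := h
    refine ⟨htb ▸ hsb, htb.le, ?_, Or.inl htb⟩
    -- Were the control above γ at b, the intermediate value theorem would give a level point
    -- strictly before b, contradicting that the infimum is b.
    by_contra hcon
    rw [not_le, htb] at hcon
    obtain ⟨r, hr, hrγ⟩ := intermediate_value_Icc hsb.le
      (hx.continuousOn_greedyControl hα hα' hαν)
      (show γ ∈ Icc (greedyControl α x X s s) (greedyControl α x X s b) from
        ⟨by rw [greedyControl_self hα']; exact hγ.le, hcon.le⟩)
    have hrb : r < b := lt_of_le_of_ne hr.2 (by rintro rfl; exact hcon.ne' hrγ)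
    have hsr : s < r := lt_of_le_of_ne hr.1 (by
      rintro rfl
      rw [greedyControl_self hα'] at hrγ
      exact hγ.ne hrγ)
    have hle : t ≤ r := by
      rw [ht]
      refine csInf_le ⟨s, ?_⟩ (Or.inl ⟨hsr, hr.2, hrγ⟩)
      rintro q (⟨hq, -⟩ | hq)
      · exact hq.le
      · rw [mem_singleton_iff.1 hq]; exact hsb.le
    linarith

lemma greedyTime_succ_of_eq {i : ℕ} (h : greedyTime γ α x X a b i = b) :
    greedyTime γ α x X a b (i + 1) = b := by
  rw [greedyTime_succ, h]
  have : {t : ℝ | b < t ∧ t ≤ b ∧ greedyControl α x X b t = γ} = ∅ := by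
    ext t
    simp only [mem_ofPred_eq, mem_empty_iff_false, iff_false]
    rintro ⟨h1, h2, -⟩
    linarith
  rw [this, empty_union, csInf_singleton]

lemma IsRoughPath.greedyTime_mem (hα : 0 < α) (hα' : α < 1 / 2) (hαν : α < ν)
    (hx : IsRoughPath ν x X a b) (hγ : 0 < γ) (hab : a ≤ b) (i : ℕ) :
    a ≤ greedyTime γ α x X a b i ∧ greedyTime γ α x X a b i ≤ b := by
  induction i with
  | zero => exact ⟨le_rfl, hab⟩
  | succ i ih =>
    rcases ih.2.eq_or_lt with h | h
    · rw [greedyTime_succ_of_eq h]; exact ⟨hab, le_rfl⟩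
    · obtain ⟨h1, h2, -⟩ := (hx.mono ih.1 le_rfl).sInf_greedy_spec hα hα' hαν hγ h
        (greedyTime_succ γ α x X a b i)
      exact ⟨ih.1.trans h1.le, h2⟩

lemma IsRoughPath.greedyTime_succ_spec (hα : 0 < α) (hα' : α < 1 / 2) (hαν : α < ν)
    (hx : IsRoughPath ν x X a b) (hγ : 0 < γ) (hab : a ≤ b) {i : ℕ}
    (hi : greedyTime γ α x X a b i < b) :
    greedyTime γ α x X a b i < greedyTime γ α x X a b (i + 1) ∧
      greedyControl α x X (greedyTime γ α x X a b i) (greedyTime γ α x X a b (i + 1)) ≤ γ ∧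
      (greedyTime γ α x X a b (i + 1) = b ∨
        greedyControl α x X (greedyTime γ α x X a b i) (greedyTime γ α x X a b (i + 1)) = γ) := by
  have hm := hx.greedyTime_mem hα hα' hαν hγ hab i
  obtain ⟨h1, -, h3, h4⟩ := (hx.mono hm.1 le_rfl).sInf_greedy_spec hα hα' hαν hγ hi
    (greedyTime_succ γ α x X a b i)
  exact ⟨h1, h3, h4⟩

lemma IsRoughPath.exists_greedyTime_eq (hα : 0 < α) (hα' : α < 1 / 2) (hαν : α < ν)
    (hx : IsRoughPath ν x X a b) (hγ : 0 < γ) (hab : a ≤ b) :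
    ∃ i, greedyTime γ α x X a b i = b := by
  obtain ⟨δ, hδ, H⟩ := hx.exists_greedyControl_lt hα' hαν hγ
  have key : ∀ i : ℕ, greedyTime γ α x X a b i = b ∨ a + i * δ ≤ greedyTime γ α x X a b i := by
    intro i
    induction i with
    | zero => right; simp [greedyTime]
    | succ i ih =>
      have hm := hx.greedyTime_mem hα hα' hαν hγ hab i
      have hm' := hx.greedyTime_mem hα hα' hαν hγ hab (i + 1)
      rcases hm.2.eq_or_lt with h | h
      · exact Or.inl (greedyTime_succ_of_eq h)
      · obtain ⟨h1, h3, h4⟩ := hx.greedyTime_succ_spec hα hα' hαν hγ hab h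
        refine h4.imp_right fun h4 => ?_
        have h5 := ih.resolve_left h.ne
        by_contra hcon
        push Not at hcon
        push_cast at hcon
        exact (H _ _ hm.1 h1.le hm'.2 (by linarith)).ne h4
  obtain ⟨i, hi⟩ := exists_nat_gt ((b - a) / δ)
  rw [div_lt_iff₀ hδ] at hi
  refine ⟨i, (key i).resolve_right fun h => ?_⟩
  linarith [(hx.greedyTime_mem hα hα' hαν hγ hab i).2]

end Greedy

/-! ### A priori estimate on one greedy interval -/

section Interval

/-- Dictionary: c = ‖C‖, G = ‖A‖ + C_f, p = [x]_α, q = [X]_{2α}^(1/2), l and lam the powers 1-2α and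
α of the length, S = sup‖y‖, N the norm of the initial value, r = [R^y]_{2α}, η = [y']_α, Y = [y]_α.
The factor 1 + c in the hypothesis on γ pays for η ≤ cY in the last bound. -/
lemma closed_bounds_of_linear_bounds {c G K p q l lam S N r η Y γ μ ρ : ℝ} (hc : 0 ≤ c)
    (hG : 0 ≤ G) (hK : 0 ≤ K) (hp : 0 ≤ p) (hq : 0 ≤ q) (hl : 0 ≤ l) (hlam : 0 ≤ lam)
    (hlam1 : lam ≤ 1) (hS0 : 0 ≤ S) (hN : 0 ≤ N) (hr0 : 0 ≤ r) (hμ1 : μ < 1)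
    (hρ : ρ * (1 - μ) = 1) (hlpq : l + p + q ≤ γ) (hγ : γ * ((G + c * (1 + K)) * (1 + c)) ≤ μ)
    (hr : r ≤ l * G * S + c ^ 2 * S * q ^ 2 + K * lam * c * (p * r + η * q ^ 2))
    (hη : η ≤ c * Y) (hY : Y ≤ c * S * p + lam * r) (hS : S ≤ N + lam * Y) :
    S ≤ ρ * N ∧ Y ≤ μ * (ρ * N) ∧ η + r ≤ μ * (ρ * N) := by
  have hq2 : q ^ 2 = q * q := sq q
  have hγ0 : 0 ≤ γ := by linarith
  have hcγ : c * γ ≤ μ := by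
    refine le_trans ?_ hγ
    have h1 : 0 ≤ γ * (G * (1 + c) + c * (K + c + c * K)) := by positivity
    nlinarith
  have hcq : c * q ≤ 1 := by
    have : c * q ≤ c * γ := by gcongr; linarith
    linarith
  -- D dominates both r and Y, and S ≤ N + D, so the system reduces to the single inequality D ≤ β₁S
  -- + β₂D with (1+c)(β₁+β₂) ≤ μ. The quadratic q² terms become linear through cq ≤ 1.
  obtain ⟨D, hD⟩ : ∃ D, D = c * p * S + r := ⟨_, rfl⟩
  have hD0 : 0 ≤ D := by rw [hD]; positivity
  have hrD : r ≤ D := by rw [hD]; linarith [show 0 ≤ c * p * S by positivity]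
  have hYD : Y ≤ D := by
    rw [hD]
    linarith [mul_le_mul_of_nonneg_right hlam1 hr0]
  have hSD : S ≤ N + D := by
    have h1 : lam * Y ≤ lam * D := mul_le_mul_of_nonneg_left hYD hlam
    have h2 : lam * D ≤ D := by linarith [mul_le_mul_of_nonneg_right hlam1 hD0]
    linarith
  have hηD : η * q ^ 2 ≤ q * D := by
    calc η * q ^ 2 ≤ (c * D) * q ^ 2 := by
          gcongr
          exact hη.trans (mul_le_mul_of_nonneg_left hYD hc)
      _ = (c * q) * (q * D) := by ring
      _ ≤ 1 * (q * D) := by gcongr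
      _ = _ := one_mul _
  obtain ⟨β₁, hβ₁⟩ : ∃ β₁, β₁ = l * G + c * (p + q) := ⟨_, rfl⟩
  obtain ⟨β₂, hβ₂⟩ : ∃ β₂, β₂ = K * c * (p + q) := ⟨_, rfl⟩
  have hβ₁0 : 0 ≤ β₁ := by rw [hβ₁]; positivity
  have hβ₂0 : 0 ≤ β₂ := by rw [hβ₂]; positivity
  have hβ : (1 + c) * (β₁ + β₂) ≤ μ := by
    refine le_trans ?_ hγ
    calc (1 + c) * (β₁ + β₂) ≤ (1 + c) * ((G + c * (1 + K)) * (l + p + q)) := by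
          refine mul_le_mul_of_nonneg_left ?_ (by linarith)
          rw [hβ₁, hβ₂]
          have : 0 ≤ G * (p + q) + c * (1 + K) * l := by positivity
          linarith
      _ ≤ (1 + c) * ((G + c * (1 + K)) * γ) := by gcongr
      _ = _ := by ring
  have hβ' : β₁ + β₂ ≤ μ := by
    have : 0 ≤ c * (β₁ + β₂) := by positivity
    linarith
  have hDle : D ≤ β₁ * S + β₂ * D := by
    have h1 : c ^ 2 * S * q ^ 2 ≤ c * q * S := by
      calc c ^ 2 * S * q ^ 2 = (c * q) * (c * q * S) := by ring
        _ ≤ 1 * (c * q * S) := by gcongr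
        _ = _ := one_mul _
    have h2 : K * lam * c * (p * r + η * q ^ 2) ≤ K * c * (p + q) * D := by
      calc K * lam * c * (p * r + η * q ^ 2) ≤ K * lam * c * (p * D + q * D) := by gcongr
        _ ≤ K * 1 * c * (p * D + q * D) := by gcongr
        _ = _ := by ring
    rw [hβ₁, hβ₂]
    nlinarith
  have hρ0 : 0 < ρ := by
    by_contra hcon
    have h1 : ρ * (1 - μ) ≤ 0 := mul_nonpos_of_nonpos_of_nonneg (not_lt.1 hcon) (by linarith)
    linarith
  have hDμ : D ≤ μ * (ρ * N) := by
    have h1 : D ≤ β₁ * (N + D) + β₂ * D :=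
      hDle.trans (add_le_add (mul_le_mul_of_nonneg_left hSD hβ₁0) le_rfl)
    have h2 : (β₁ + β₂) * D ≤ μ * D := mul_le_mul_of_nonneg_right hβ' hD0
    have h3 : β₁ * N ≤ μ * N := mul_le_mul_of_nonneg_right (by linarith) hN
    have h4 : D * (1 - μ) ≤ μ * N := by linarith
    calc D = ρ * (D * (1 - μ)) := by linear_combination (-D) * hρ
      _ ≤ ρ * (μ * N) := mul_le_mul_of_nonneg_left h4 hρ0.le
      _ = _ := by ring
  have hSρ : S ≤ ρ * N := by
    have : N + μ * (ρ * N) = ρ * N := by linear_combination (-N) * hρ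
    linarith
  have hρN : 0 ≤ ρ * N := by positivity
  refine ⟨hSρ, hYD.trans hDμ, ?_⟩
  have hDρ : D ≤ ρ * N := hDμ.trans (by linarith [mul_le_mul_of_nonneg_right hμ1.le hρN])
  calc η + r ≤ (1 + c) * D := by
        have h1 := mul_le_mul_of_nonneg_left hYD hc
        linarith
    _ ≤ (1 + c) * (β₁ * (ρ * N) + β₂ * (ρ * N)) := by
        refine mul_le_mul_of_nonneg_left (hDle.trans ?_) (by linarith)
        gcongr
    _ = (1 + c) * (β₁ + β₂) * (ρ * N) := by ring
    _ ≤ μ * (ρ * N) := mul_le_mul_of_nonneg_right hβ hρN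

variable {d m : ℕ} {α a b s₀ t₀ : ℝ} {x : ℝ → EuclideanSpace ℝ (Fin m)}
  {X : ℝ → ℝ → EuclideanSpace ℝ (Fin m × Fin m)} {A : Matrix (Fin d) (Fin d) ℝ}
  {C : Fin m → Matrix (Fin d) (Fin d) ℝ} {f : EuclideanSpace ℝ (Fin d) → EuclideanSpace ℝ (Fin d)}
  {y : ℝ → EuclideanSpace ℝ (Fin d)} {y' : ℝ → EuclideanSpace ℝ (Fin d × Fin m)}

lemma incr_diffusion (C : Fin m → Matrix (Fin d) (Fin d) ℝ) (y : ℝ → EuclideanSpace ℝ (Fin d))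
    (s t : ℝ) : incr (fun u => diffusion C (y u)) s t = diffusion C (incr y s t) := by
  simp only [incr, map_sub]

lemma incr_diffusionDeriv (C : Fin m → Matrix (Fin d) (Fin d) ℝ)
    (y' : ℝ → EuclideanSpace ℝ (Fin d × Fin m)) (s t : ℝ) :
    incr (fun u => diffusionDeriv C (y' u)) s t = diffusionDeriv C (incr y' s t) := by
  simp only [incr, diffusionDeriv_sub]

lemma remainder_diffusion (C : Fin m → Matrix (Fin d) (Fin d) ℝ)
    (x : ℝ → EuclideanSpace ℝ (Fin m)) (y : ℝ → EuclideanSpace ℝ (Fin d))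
    (y' : ℝ → EuclideanSpace ℝ (Fin d × Fin m)) (s t : ℝ) :
    remainder x (fun u => diffusion C (y u)) (fun u => diffusionDeriv C (y' u)) s t
      = diffusion C (remainder x y y' s t) := by
  rw [remainder, incr_diffusion, act_diffusionDeriv, remainder, map_sub]

lemma norm_incr_diffusion_le (C : Fin m → Matrix (Fin d) (Fin d) ℝ)
    (y : ℝ → EuclideanSpace ℝ (Fin d)) (s t : ℝ) :
    ‖incr (fun u => diffusion C (y u)) s t‖ ≤ ‖diffusion C‖ * ‖incr y s t‖ := by
  rw [incr_diffusion]; exact (diffusion C).le_opNorm _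

lemma norm_incr_diffusionDeriv_le (C : Fin m → Matrix (Fin d) (Fin d) ℝ)
    (y' : ℝ → EuclideanSpace ℝ (Fin d × Fin m)) (s t : ℝ) :
    ‖incr (fun u => diffusionDeriv C (y' u)) s t‖ ≤ ‖diffusion C‖ * ‖incr y' s t‖ := by
  rw [incr_diffusionDeriv]; exact norm_diffusionDeriv_le _ _

lemma norm_remainder_diffusion_le (C : Fin m → Matrix (Fin d) (Fin d) ℝ)
    (x : ℝ → EuclideanSpace ℝ (Fin m)) (y : ℝ → EuclideanSpace ℝ (Fin d))
    (y' : ℝ → EuclideanSpace ℝ (Fin d × Fin m)) (s t : ℝ) :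
    ‖remainder x (fun u => diffusion C (y u)) (fun u => diffusionDeriv C (y' u)) s t‖
      ≤ ‖diffusion C‖ * ‖remainder x y y' s t‖ := by
  rw [remainder_diffusion]; exact (diffusion C).le_opNorm _

lemma IsControlled.diffusion (hy : IsControlled α x y y' a b) :
    IsControlled α x (fun u => diffusion C (y u)) (fun u => diffusionDeriv C (y' u)) a b :=
  ⟨hy.path.comp_le (norm_nonneg (RoughLinear.diffusion C))
      fun s t _ _ _ => norm_incr_diffusion_le C y s t,
    hy.deriv.comp_le (norm_nonneg (RoughLinear.diffusion C))
      fun s t _ _ _ => norm_incr_diffusionDeriv_le C y' s t,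
    hy.rem.comp_le (norm_nonneg (RoughLinear.diffusion C))
      fun s t _ _ _ => norm_remainder_diffusion_le C x y y' s t⟩

/-- The drift along a path. -/
def drift (A : Matrix (Fin d) (Fin d) ℝ)
    (f : EuclideanSpace ℝ (Fin d) → EuclideanSpace ℝ (Fin d))
    (y : ℝ → EuclideanSpace ℝ (Fin d)) (u : ℝ) : EuclideanSpace ℝ (Fin d) :=
  Matrix.toEuclideanCLM (𝕜 := ℝ) A (y u) + f (y u)

lemma norm_drift_le {Cf : ℝ} (hf : ∀ v, ‖f v‖ ≤ Cf * ‖v‖) (u : ℝ) :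
    ‖drift A f y u‖ ≤ (‖Matrix.toEuclideanCLM (𝕜 := ℝ) A‖ + Cf) * ‖y u‖ := by
  rw [add_mul]
  exact norm_add_le_of_le (ContinuousLinearMap.le_opNorm _ _) (hf _)

lemma IsSolution.continuousOn (hα : 0 < α) (hy : IsSolution α A f C x X a b y y') :
    ContinuousOn y (Icc a b) := hy.controlled.path.continuousOn hα

/-- The remainder is drift + (Cy)'X + integral error. The drift has spare power 1-2α of the length,
which is why that power enters the greedy control; the error has spare power α. -/
lemma IsSolution.norm_remainder_sub_le {K Cf S : ℝ} (hα : 0 < α) (hα' : α < 1 / 2)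
    (hK : IsRoughConst α K) (hx : IsRoughPath α x X a b) (hf : Continuous f) (hCf : 0 ≤ Cf)
    (hf' : ∀ v, ‖f v‖ ≤ Cf * ‖v‖) (hy : IsSolution α A f C x X a b y y') (has : a ≤ s₀)
    (hst₀ : s₀ < t₀) (htb : t₀ ≤ b) (hlen : t₀ - s₀ ≤ 1)
    (hS : ∀ t ∈ Icc s₀ t₀, ‖y t‖ ≤ S) :
    holderSemi₂ (2 * α) (remainder x y y') s₀ t₀ ≤
      (t₀ - s₀) ^ (1 - 2 * α) * (‖Matrix.toEuclideanCLM (𝕜 := ℝ) A‖ + Cf) * S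
        + ‖diffusion C‖ ^ 2 * S * holderSemi₂ (2 * α) X s₀ t₀
        + K * (t₀ - s₀) ^ α * ‖diffusion C‖ *
          (holderSemi₂ α (incr x) s₀ t₀ * holderSemi₂ (2 * α) (remainder x y y') s₀ t₀
            + holderSemi₂ α (incr y') s₀ t₀ * holderSemi₂ (2 * α) X s₀ t₀) := by
  have hx' := hx.mono has htb
  have hc' := hy.controlled.mono has htb
  have hcd := hc'.diffusion (C := C)
  set c := ‖diffusion C‖ with hc
  set p := holderSemi₂ α (incr x) s₀ t₀ with hp
  set q := holderSemi₂ (2 * α) X s₀ t₀ with hq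
  set r := holderSemi₂ (2 * α) (remainder x y y') s₀ t₀ with hr
  set η := holderSemi₂ α (incr y') s₀ t₀ with hη
  set G := ‖Matrix.toEuclideanCLM (𝕜 := ℝ) A‖ + Cf with hG
  have c0 : 0 ≤ c := norm_nonneg _
  have p0 : 0 ≤ p := holderSemi₂_nonneg _ _ _ _
  have q0 : 0 ≤ q := holderSemi₂_nonneg _ _ _ _
  have r0 : 0 ≤ r := holderSemi₂_nonneg _ _ _ _
  have η0 : 0 ≤ η := holderSemi₂_nonneg _ _ _ _
  have G0 : 0 ≤ G := add_nonneg (norm_nonneg _) hCf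
  have S0 : 0 ≤ S := (norm_nonneg _).trans (hS s₀ ⟨le_rfl, hst₀.le⟩)
  have K0 : 0 ≤ K := by linarith [hK.1]
  have L0 : 0 ≤ t₀ - s₀ := by linarith
  refine holderSemi₂_le (by positivity) fun s t hs hst ht => ?_
  obtain ⟨J, hJ, hJle⟩ := hK.2 d m s₀ t₀ hst₀ hlen x X hx' _ _ hcd s t hs hst.le ht
  have mem_s : s ∈ Icc a b := ⟨has.trans hs, (hst.le.trans ht).trans htb⟩
  have mem_t : t ∈ Icc a b := ⟨mem_s.1.trans hst.le, ht.trans htb⟩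
  have hcont : ContinuousOn (drift A f y) (Icc a b) :=
    ((ContinuousLinearMap.continuous _).comp_continuousOn (hy.continuousOn hα)).add
      (hf.comp_continuousOn (hy.continuousOn hα))
  have hint : ∀ u ∈ Icc a b, IntervalIntegrable (drift A f y) MeasureTheory.volume a u := by
    intro u hu
    refine ContinuousOn.intervalIntegrable (hcont.mono ?_)
    rw [uIcc_of_le hu.1]
    exact Icc_subset_Icc_right hu.2
  have hJeq : J = y t - y s - ∫ u in s..t, drift A f y u := by
    rw [(hy.equation s mem_s).eq_sub mem_s.1 hst.le (hy.equation t mem_t) hJ,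
      ← intervalIntegral.integral_interval_sub_left (hint t mem_t) (hint s mem_s)]
    simp only [drift]
    abel
  have D0 : 0 < t - s := sub_pos.2 hst
  have hdrift : ‖∫ u in s..t, drift A f y u‖ ≤ (t₀ - s₀) ^ (1 - 2 * α) * G * S
      * (t - s) ^ (2 * α) := by
    have h1 : ‖∫ u in s..t, drift A f y u‖ ≤ G * S * |t - s| := by
      refine intervalIntegral.norm_integral_le_of_norm_le_const fun u hu => ?_
      rw [uIoc_of_le hst.le] at hu
      refine (norm_drift_le hf' u).trans ?_
      gcongr
      exact hS u ⟨hs.trans hu.1.le, hu.2.trans ht⟩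
    refine h1.trans ?_
    rw [abs_of_pos D0]
    calc G * S * (t - s) = (t - s) ^ (1 - 2 * α) * G * S * (t - s) ^ (2 * α) := by
          have : (t - s) ^ (1 - 2 * α) * (t - s) ^ (2 * α) = t - s := by
            rw [← Real.rpow_add D0, sub_add_cancel, Real.rpow_one]
          linear_combination (-(G * S)) * this
      _ ≤ _ := by
          have : 0 ≤ 1 - 2 * α := by linarith
          gcongr
  have hsecond : ‖act₂ (diffusionDeriv C (y' s)) (X s t)‖ ≤ c ^ 2 * S * q * (t - s) ^ (2 * α) := by
    refine (norm_act₂_le _ _).trans ?_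
    have h1 : ‖diffusionDeriv C (y' s)‖ ≤ c * (c * S) := by
      refine (norm_diffusionDeriv_le _ _).trans (mul_le_mul_of_nonneg_left ?_ c0)
      rw [hy.deriv_eq s mem_s]
      exact ((diffusion C).le_opNorm _).trans
        (mul_le_mul_of_nonneg_left (hS s ⟨hs, hst.le.trans ht⟩) c0)
    calc _ ≤ c * (c * S) * (q * (t - s) ^ (2 * α)) :=
          mul_le_mul h1 (hx'.holder₂.norm_le hs hst ht) (norm_nonneg _) (by positivity)
      _ = _ := by ring
  have hthird : ‖J - germ x X (fun u => diffusion C (y u)) (fun u => diffusionDeriv C (y' u)) s t‖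
      ≤ K * (t₀ - s₀) ^ α * c * (p * r + η * q) * (t - s) ^ (2 * α) := by
    refine hJle.trans ?_
    have e1 : holderSemi₂ α (incr x) s t ≤ p := holderSemi₂_mono hx'.holder hs ht
    have e2 : holderSemi₂ (2 * α) (remainder x (fun u => diffusion C (y u))
        (fun u => diffusionDeriv C (y' u))) s t ≤ c * r :=
      (holderSemi₂_mono hcd.rem hs ht).trans
        (holderSemi₂_comp_le c0 hc'.rem fun s t _ _ _ => norm_remainder_diffusion_le C x y y' s t)
    have e3 : holderSemi₂ α (incr fun u => diffusionDeriv C (y' u)) s t ≤ c * η :=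
      (holderSemi₂_mono hcd.deriv hs ht).trans
        (holderSemi₂_comp_le c0 hc'.deriv fun s t _ _ _ => norm_incr_diffusionDeriv_le C y' s t)
    have e4 : holderSemi₂ (2 * α) X s t ≤ q := holderSemi₂_mono hx'.holder₂ hs ht
    have e5 : (t - s) ^ (3 * α) ≤ (t₀ - s₀) ^ α * (t - s) ^ (2 * α) := by
      rw [show 3 * α = α + 2 * α by ring, Real.rpow_add D0]
      gcongr
    have f1 := mul_le_mul e1 e2 (holderSemi₂_nonneg _ _ _ _) p0
    have f2 := mul_le_mul e3 e4 (holderSemi₂_nonneg _ _ _ _) (mul_nonneg c0 η0)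
    calc _ ≤ K * ((t₀ - s₀) ^ α * (t - s) ^ (2 * α)) * (p * (c * r) + c * η * q) := by
          gcongr
          exact add_nonneg (mul_nonneg (holderSemi₂_nonneg _ _ _ _) (holderSemi₂_nonneg _ _ _ _))
            (mul_nonneg (holderSemi₂_nonneg _ _ _ _) (holderSemi₂_nonneg _ _ _ _))
      _ = _ := by ring
  have hdecomp : remainder x y y' s t = (∫ u in s..t, drift A f y u)
      + act₂ (diffusionDeriv C (y' s)) (X s t)
      + (J - germ x X (fun u => diffusion C (y u)) (fun u => diffusionDeriv C (y' u)) s t) := by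
    rw [hJeq, germ, remainder, incr, hy.deriv_eq s mem_s]
    abel
  rw [hdecomp, add_mul, add_mul]
  exact norm_add_le_of_le (norm_add_le_of_le hdrift hsecond) hthird

lemma IsSolution.holderSemi₂_deriv_le (hy : IsSolution α A f C x X a b y y') {s t : ℝ}
    (hs : a ≤ s) (ht : t ≤ b) :
    holderSemi₂ α (incr y') s t ≤ ‖diffusion C‖ * holderSemi₂ α (incr y) s t := by
  refine holderSemi₂_comp_le (norm_nonneg _) (hy.controlled.path.mono hs ht) fun u v h1 h2 h3 => ?_
  rw [incr, hy.deriv_eq u ⟨hs.trans h1, (h2.le.trans h3).trans ht⟩,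
    hy.deriv_eq v ⟨(hs.trans h1).trans h2.le, h3.trans ht⟩]
  exact norm_incr_diffusion_le C y u v

lemma IsSolution.holderSemi₂_incr_le {S : ℝ} (hα : 0 < α) (hx : IsRoughPath α x X a b)
    (hy : IsSolution α A f C x X a b y y') (has : a ≤ s₀) (hst₀ : s₀ ≤ t₀) (htb : t₀ ≤ b)
    (hS : ∀ t ∈ Icc s₀ t₀, ‖y t‖ ≤ S) :
    holderSemi₂ α (incr y) s₀ t₀ ≤ ‖diffusion C‖ * S * holderSemi₂ α (incr x) s₀ t₀
      + (t₀ - s₀) ^ α * holderSemi₂ (2 * α) (remainder x y y') s₀ t₀ := by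
  have S0 : 0 ≤ S := (norm_nonneg _).trans (hS s₀ ⟨le_rfl, hst₀⟩)
  have p0 := holderSemi₂_nonneg α (incr x) s₀ t₀
  have r0 := holderSemi₂_nonneg (2 * α) (remainder x y y') s₀ t₀
  have L0 : 0 ≤ t₀ - s₀ := by linarith
  refine holderSemi₂_le (by positivity) fun s t hs hst ht => ?_
  have D0 : 0 < t - s := sub_pos.2 hst
  have mem_s : s ∈ Icc a b := ⟨has.trans hs, (hst.le.trans ht).trans htb⟩
  have e : incr y s t = act (diffusion C (y s)) (incr x s t) + remainder x y y' s t := by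
    rw [remainder, hy.deriv_eq s mem_s]; abel
  rw [e, add_mul]
  refine norm_add_le_of_le ?_ ?_
  · have h1 : ‖diffusion C (y s)‖ ≤ ‖diffusion C‖ * S :=
      ((diffusion C).le_opNorm _).trans
        (mul_le_mul_of_nonneg_left (hS s ⟨hs, hst.le.trans ht⟩) (norm_nonneg _))
    refine ((norm_act_le _ _).trans (mul_le_mul h1 ((hx.mono has htb).holder.norm_le hs hst ht)
      (norm_nonneg _) (by positivity))).trans_eq ?_
    ring
  · refine ((hy.controlled.mono has htb).rem.norm_le hs hst ht).trans ?_
    rw [two_mul, Real.rpow_add D0, ← two_mul]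
    calc _ = (t - s) ^ α * holderSemi₂ (2 * α) (remainder x y y') s₀ t₀ * (t - s) ^ α := by ring
      _ ≤ _ := by gcongr

lemma IsSolution.interval_estimate {K Cf γ μ ρ : ℝ} (hα : 0 < α) (hα' : α < 1 / 2)
    (hK : IsRoughConst α K) (hx : IsRoughPath α x X a b) (hf : Continuous f) (hCf : 0 ≤ Cf)
    (hf' : ∀ v, ‖f v‖ ≤ Cf * ‖v‖) (hy : IsSolution α A f C x X a b y y') (has : a ≤ s₀)
    (hst₀ : s₀ < t₀) (htb : t₀ ≤ b) (hγ : γ < 1) (hμ : μ < 1) (hρ : ρ * (1 - μ) = 1)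
    (hM : γ * ((‖Matrix.toEuclideanCLM (𝕜 := ℝ) A‖ + Cf + ‖diffusion C‖ * (1 + K))
      * (1 + ‖diffusion C‖)) ≤ μ)
    (hctrl : greedyControl α x X s₀ t₀ ≤ γ) :
    (∀ t ∈ Icc s₀ t₀, ‖y t‖ ≤ ρ * ‖y s₀‖) ∧
      holderSemi₂ α (incr y) s₀ t₀ ≤ μ * (ρ * ‖y s₀‖) ∧
      controlledSemi α x y y' s₀ t₀ ≤ μ * (ρ * ‖y s₀‖) := by
  have L0 : 0 < t₀ - s₀ := by linarith
  -- With γ < 1 the length term of the control forces t₀ - s₀ ≤ 1, as (*) requires; this also makes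
  -- (t₀ - s₀)^α ≤ 1.
  have hl1 : (t₀ - s₀) ^ (1 - 2 * α) < 1 := by
    have := roughSemi_nonneg α x X s₀ t₀
    rw [greedyControl] at hctrl
    linarith
  have hlen : t₀ - s₀ ≤ 1 := by
    by_contra hcon
    linarith [Real.one_le_rpow (not_le.1 hcon).le (by linarith : 0 ≤ 1 - 2 * α)]
  have hcont : ContinuousOn y (Icc s₀ t₀) := (hy.continuousOn hα).mono (Icc_subset_Icc has htb)
  have hS : ∀ t ∈ Icc s₀ t₀, ‖y t‖ ≤ supNorm y s₀ t₀ := fun t ht => norm_le_supNorm hcont ht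
  have h1 := hy.norm_remainder_sub_le hα hα' hK hx hf hCf hf' has hst₀ htb hlen hS
  have h2 := hy.holderSemi₂_deriv_le has htb
  have h3 := hy.holderSemi₂_incr_le hα hx has hst₀.le htb hS
  have h4 : supNorm y s₀ t₀ ≤ ‖y s₀‖ + (t₀ - s₀) ^ α * holderSemi₂ α (incr y) s₀ t₀ := by
    refine csSup_le ⟨_, s₀, ⟨le_rfl, hst₀.le⟩, rfl⟩ ?_
    rintro _ ⟨t, ht, rfl⟩
    have e : y t = y s₀ + incr y s₀ t := by simp [incr]
    have n1 := holderSemi₂_nonneg α (incr y) s₀ t₀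
    have n2 : 0 ≤ t - s₀ := by linarith [ht.1]
    have n3 := ht.2
    calc ‖y t‖ ≤ ‖y s₀‖ + ‖incr y s₀ t‖ := by
          conv_lhs => rw [e]
          exact norm_add_le _ _
      _ ≤ ‖y s₀‖ + holderSemi₂ α (incr y) s₀ t₀ * (t - s₀) ^ α := by
          gcongr
          exact (hy.controlled.path.mono has htb).norm_le' le_rfl ht.1 ht.2 (incr_self _ _)
      _ ≤ _ := by
          rw [mul_comm]
          gcongr
  have hsq : holderSemi₂ (2 * α) X s₀ t₀ = Real.sqrt (holderSemi₂ (2 * α) X s₀ t₀) ^ 2 :=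
    (Real.sq_sqrt (holderSemi₂_nonneg _ _ _ _)).symm
  rw [hsq] at h1
  rw [greedyControl, roughSemi, ← add_assoc] at hctrl
  obtain ⟨r1, r2, r3⟩ := closed_bounds_of_linear_bounds (norm_nonneg (diffusion C))
    (add_nonneg (norm_nonneg _) hCf) (by linarith [hK.1])
    (holderSemi₂_nonneg α (incr x) s₀ t₀) (Real.sqrt_nonneg _)
    (Real.rpow_nonneg L0.le _) (Real.rpow_nonneg L0.le _)
    (Real.rpow_le_one L0.le hlen hα.le) ((norm_nonneg _).trans (hS s₀ ⟨le_rfl, hst₀.le⟩))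
    (norm_nonneg (y s₀)) (holderSemi₂_nonneg _ _ _ _) hμ hρ hctrl hM h1 h2 h3 h4
  exact ⟨fun t ht => (hS t ht).trans r1, r2, r3⟩

end Interval

/-! ### Gluing the estimates along the greedy times -/

section Gluing

lemma holderSemi₂_concat_le {E : Type*} [NormedAddCommGroup E] {β a u b e : ℝ} {Z : ℝ → ℝ → E}
    (hβ : 0 ≤ β) (he : 0 ≤ e) (h : HolderBdd₂ β Z a b) (hau : a ≤ u) (hub : u ≤ b)
    (hZ : ∀ s t, a ≤ s → s ≤ u → u ≤ t → t ≤ b →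
      ‖Z s t‖ ≤ ‖Z s u‖ + ‖Z u t‖ + e * (t - s) ^ β) :
    holderSemi₂ β Z a b ≤ holderSemi₂ β Z a u + holderSemi₂ β Z u b + e := by
  have n1 := holderSemi₂_nonneg β Z a u
  have n2 := holderSemi₂_nonneg β Z u b
  refine holderSemi₂_le (by positivity) fun s t hs hst ht => ?_
  have n3 : 0 ≤ (t - s) ^ β := Real.rpow_nonneg (by linarith) _
  rw [add_mul, add_mul]
  rcases le_or_gt t u with htu | hut
  · have := (h.mono le_rfl hub).norm_le hs hst htu
    nlinarith [mul_nonneg n2 n3, mul_nonneg he n3]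
  rcases le_or_gt u s with hus | hsu
  · have := (h.mono hau le_rfl).norm_le hus hst ht
    nlinarith [mul_nonneg n1 n3, mul_nonneg he n3]
  · refine (hZ s t hs hsu.le hut.le ht).trans (add_le_add (add_le_add ?_ ?_) le_rfl)
    · refine ((h.mono le_rfl hub).norm_le hs hsu le_rfl).trans ?_
      have : 0 ≤ u - s := by linarith
      gcongr
    · refine ((h.mono hau le_rfl).norm_le le_rfl hut ht).trans ?_
      have : 0 ≤ t - u := by linarith
      gcongr

lemma holderSemi₂_incr_concat_le {E : Type*} [NormedAddCommGroup E] {β a u b : ℝ} {z : ℝ → E}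
    (hβ : 0 ≤ β) (h : HolderBdd₂ β (incr z) a b) (hau : a ≤ u) (hub : u ≤ b) :
    holderSemi₂ β (incr z) a b ≤ holderSemi₂ β (incr z) a u + holderSemi₂ β (incr z) u b := by
  have := holderSemi₂_concat_le hβ le_rfl h hau hub fun s t _ _ _ _ => by
    rw [← incr_add_incr z s u t, zero_mul, add_zero]
    exact norm_add_le _ _
  rwa [add_zero] at this

variable {d m : ℕ} {α ν γ a b : ℝ} {x : ℝ → EuclideanSpace ℝ (Fin m)}
  {X : ℝ → ℝ → EuclideanSpace ℝ (Fin m × Fin m)}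

lemma remainder_eq_add {ι : Type*} [Fintype ι] (x : ℝ → EuclideanSpace ℝ (Fin m))
    (z : ℝ → EuclideanSpace ℝ ι) (z' : ℝ → EuclideanSpace ℝ (ι × Fin m)) (s u t : ℝ) :
    remainder x z z' s t
      = remainder x z z' s u + remainder x z z' u t + act (incr z' s u) (incr x u t) := by
  rw [remainder, remainder, remainder, ← incr_add_incr z s u t, ← incr_add_incr x s u t,
    act_add_right, incr, incr, incr, incr, incr, act_sub_left]
  abel

/-- The derivative is an increment, hence subadditive; changing the base point of the remainder from
s to u produces z'_{s,u}x_{u,t}, whence the product term. -/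
lemma IsControlled.controlledSemi_concat_le {ι : Type*} [Fintype ι]
    {z : ℝ → EuclideanSpace ℝ ι} {z' : ℝ → EuclideanSpace ℝ (ι × Fin m)} {u : ℝ} (hα : 0 < α)
    (hz : IsControlled α x z z' a b) (hx : HolderBdd₂ α (incr x) a b) (hau : a ≤ u)
    (hub : u ≤ b) :
    controlledSemi α x z z' a b ≤ controlledSemi α x z z' a u + controlledSemi α x z z' u b
      + holderSemi₂ α (incr z') a u * holderSemi₂ α (incr x) u b := by
  have h1 := holderSemi₂_incr_concat_le hα.le hz.deriv hau hub
  have n1 := holderSemi₂_nonneg α (incr z') a u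
  have n2 := holderSemi₂_nonneg α (incr x) u b
  have h2 := holderSemi₂_concat_le (e := holderSemi₂ α (incr z') a u * holderSemi₂ α (incr x) u b)
    (by linarith) (by positivity) hz.rem hau hub fun s t hs hsu hut ht => by
      rw [remainder_eq_add x z z' s u t]
      refine norm_add_le_of_le (norm_add_le _ _) ((norm_act_le _ _).trans ?_)
      have e1 := (hz.deriv.mono le_rfl hub).norm_le' hs hsu le_rfl (incr_self _ _)
      have e2 := (hx.mono hau le_rfl).norm_le' le_rfl hut ht (incr_self _ _)
      have p1 : 0 ≤ u - s := by linarith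
      have p2 : 0 ≤ t - u := by linarith
      have p3 : 0 ≤ t - s := by linarith
      rw [two_mul α, Real.rpow_add_of_nonneg p3 hα.le hα.le]
      calc _ ≤ (holderSemi₂ α (incr z') a u * (t - s) ^ α)
            * (holderSemi₂ α (incr x) u b * (t - s) ^ α) := by
            refine mul_le_mul (e1.trans ?_) (e2.trans ?_) (norm_nonneg _) (by positivity)
            · gcongr
            · gcongr
        _ = _ := by ring
  rw [controlledSemi, controlledSemi, controlledSemi]
  linarith

variable {A : Matrix (Fin d) (Fin d) ℝ}
  {C : Fin m → Matrix (Fin d) (Fin d) ℝ} {f : EuclideanSpace ℝ (Fin d) → EuclideanSpace ℝ (Fin d)}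
  {y : ℝ → EuclideanSpace ℝ (Fin d)} {y' : ℝ → EuclideanSpace ℝ (Fin d × Fin m)}

lemma IsSolution.greedy_estimate {K Cf μ ρ : ℝ} (hα : 0 < α) (hα' : α < 1 / 2) (hαν : α < ν)
    (hK : IsRoughConst α K) (hab : a ≤ b) (hx : IsRoughPath ν x X a b) (hf : Continuous f)
    (hCf : 0 ≤ Cf) (hf' : ∀ v, ‖f v‖ ≤ Cf * ‖v‖) (hy : IsSolution α A f C x X a b y y')
    (hγ0 : 0 < γ) (hγ : γ < 1) (hμ0 : 0 < μ) (hμ : μ < 1) (hρ : ρ * (1 - μ) = 1)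
    (hM : γ * ((‖Matrix.toEuclideanCLM (𝕜 := ℝ) A‖ + Cf + ‖diffusion C‖ * (1 + K))
      * (1 + ‖diffusion C‖)) ≤ μ) (k : ℕ)
    (hk : ∀ i < k, greedyTime γ α x X a b i < b) :
    (∀ t ∈ Icc a (greedyTime γ α x X a b k), ‖y t‖ ≤ ρ ^ k * ‖y a‖) ∧
      holderSemi₂ α (incr y) a (greedyTime γ α x X a b k) ≤ (ρ ^ k - 1) * ‖y a‖ ∧
      controlledSemi α x y y' a (greedyTime γ α x X a b k) ≤ (μ + ρ) ^ k * ‖y a‖ := by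
  have hx' := hx.of_le hαν.le
  have hμρ : μ * ρ = ρ - 1 := by linear_combination -hρ
  have hρ1 : 1 ≤ ρ := by
    have : 0 < ρ := by
      by_contra hcon
      have h1 : ρ * (1 - μ) ≤ 0 := mul_nonpos_of_nonpos_of_nonneg (not_lt.1 hcon) (by linarith)
      linarith
    linarith [mul_pos hμ0 this]
  induction k with
  | zero => simp [greedyTime, controlledSemi]
  | succ k ih =>
    obtain ⟨i1, i2, i3⟩ := ih fun i hi => hk i (by omega)
    have hmem := hx.greedyTime_mem hα hα' hαν hγ0 hab k
    have hmem' := hx.greedyTime_mem hα hα' hαν hγ0 hab (k + 1)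
    obtain ⟨hlt, hctrl, -⟩ := hx.greedyTime_succ_spec hα hα' hαν hγ0 hab (hk k (by omega))
    set u := greedyTime γ α x X a b k
    set t := greedyTime γ α x X a b (k + 1)
    obtain ⟨j1, j2, j3⟩ := hy.interval_estimate hα hα' hK hx' hf hCf hf' hmem.1 hlt hmem'.2 hγ hμ
      hρ hM hctrl
    have hyu := i1 u ⟨hmem.1, le_rfl⟩
    have N0 := norm_nonneg (y a)
    have P1 : 1 ≤ ρ ^ k := one_le_pow₀ hρ1
    have hstep : μ * (ρ * ‖y u‖) ≤ (ρ - 1) * (ρ ^ k * ‖y a‖) := by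
      rw [← mul_assoc, hμρ]
      exact mul_le_mul_of_nonneg_left hyu (by linarith)
    refine ⟨fun r hr => ?_, ?_, ?_⟩
    · rw [pow_succ']
      rcases le_total r u with h | h
      · refine (i1 r ⟨hr.1, h⟩).trans ?_
        gcongr
        nlinarith
      · refine (j1 r ⟨h, hr.2⟩).trans ?_
        rw [mul_assoc]
        exact mul_le_mul_of_nonneg_left hyu (by linarith)
    · have := holderSemi₂_incr_concat_le hα.le (hy.controlled.path.mono le_rfl hmem'.2) hmem.1
        hlt.le
      rw [pow_succ]
      linarith
    · have h1 := (hy.controlled.mono le_rfl hmem'.2).controlledSemi_concat_le hα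
        (hx'.holder.mono le_rfl hmem'.2) hmem.1 hlt.le
      have h2 : holderSemi₂ α (incr y') a u ≤ ‖diffusion C‖ * ((ρ ^ k - 1) * ‖y a‖) :=
        (hy.holderSemi₂_deriv_le le_rfl hmem.2).trans
          (mul_le_mul_of_nonneg_left i2 (norm_nonneg _))
      have h3 : holderSemi₂ α (incr x) u t ≤ γ := by
        have n1 := Real.sqrt_nonneg (holderSemi₂ (2 * α) X u t)
        have n2 : 0 ≤ (t - u) ^ (1 - 2 * α) := Real.rpow_nonneg (by linarith) _
        rw [greedyControl, roughSemi] at hctrl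
        linarith
      have h4 : ‖diffusion C‖ * γ ≤ μ := by
        refine le_trans ?_ hM
        have c0 := norm_nonneg (diffusion C)
        have A0 := norm_nonneg (Matrix.toEuclideanCLM (𝕜 := ℝ) A)
        have K1 := hK.1
        set c := ‖diffusion C‖
        have : 0 ≤ γ * ((‖Matrix.toEuclideanCLM (𝕜 := ℝ) A‖ + Cf) * (1 + c)
          + c * (K + c + c * K)) := by positivity
        linarith
      have h5 : holderSemi₂ α (incr y') a u * holderSemi₂ α (incr x) u t
          ≤ μ * ((ρ ^ k - 1) * ‖y a‖) := by
        have h6 : 0 ≤ (ρ ^ k - 1) * ‖y a‖ := mul_nonneg (by linarith) N0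
        calc _ ≤ (‖diffusion C‖ * ((ρ ^ k - 1) * ‖y a‖)) * γ :=
              mul_le_mul h2 h3 (holderSemi₂_nonneg _ _ _ _) (mul_nonneg (norm_nonneg _) h6)
          _ = (‖diffusion C‖ * γ) * ((ρ ^ k - 1) * ‖y a‖) := by ring
          _ ≤ _ := mul_le_mul_of_nonneg_right h4 h6
      have h7 : ρ ^ k ≤ (μ + ρ) ^ k := by gcongr; linarith
      -- Past, new interval and cross term; the -1 in the cross term is dropped and ρ^k is enlarged
      -- to (μ+ρ)^k, so that μ+ρ factors out.
      calc _ ≤ (μ + ρ) ^ k * ‖y a‖ + (ρ - 1) * (ρ ^ k * ‖y a‖) + μ * (ρ ^ k * ‖y a‖) := by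
            linarith [mul_nonneg hμ0.le N0]
        _ = (μ + ρ) ^ k * ‖y a‖ + (ρ - 1 + μ) * (ρ ^ k * ‖y a‖) := by ring
        _ ≤ (μ + ρ) ^ k * ‖y a‖ + (ρ - 1 + μ) * ((μ + ρ) ^ k * ‖y a‖) := by
            have : 0 ≤ ρ - 1 + μ := by linarith
            gcongr
        _ = _ := by rw [pow_succ]; ring

end Gluing

end RoughLinear

end

/-! ### Assembly of the theorem -/

theorem mainTheorem7 (ν α : ℝ) (hα : 1 / 3 < α) (hαν : α < ν) (hν : ν < 1 / 2) :
    (∃ Cα : ℝ, RoughLinear.IsRoughConst α Cα) ∧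
    ∀ Cα : ℝ, RoughLinear.IsRoughConst α Cα →
    ∀ (d m : ℕ) (A : Matrix (Fin d) (Fin d) ℝ) (C : Fin m → Matrix (Fin d) (Fin d) ℝ)
      (f : EuclideanSpace ℝ (Fin d) → EuclideanSpace ℝ (Fin d)) (h : ℝ → ℝ) (Cf : ℝ),
    LocallyLipschitz f → f 0 = 0 →
    MonotoneOn h (Set.Ici 0) → (∀ r : ℝ, 0 ≤ r → 0 ≤ h r ∧ h r ≤ Cf) →
    (∀ v, ‖f v‖ ≤ ‖v‖ * h ‖v‖) →
    ∀ (a b : ℝ), a < b →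
    ∀ (x : ℝ → EuclideanSpace ℝ (Fin m)) (X : ℝ → ℝ → EuclideanSpace ℝ (Fin m × Fin m)),
    RoughLinear.IsRoughPath ν x X a b →
    ∀ (y : ℝ → EuclideanSpace ℝ (Fin d)) (y' : ℝ → EuclideanSpace ℝ (Fin d × Fin m)),
    RoughLinear.IsSolution α A f C x X a b y y' →
    ∀ μ : ℝ, 0 < μ → μ < 1 →
    ∀ γ : ℝ, 0 < γ → γ < 1 → γ ≤ μ / RoughLinear.bigM A Cf C Cα →
      (∃ i : ℕ, RoughLinear.greedyTime γ α x X a b i = b) ∧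
      RoughLinear.controlledSemi α x y y' a b ≤
        ‖y a‖ * Real.exp ((RoughLinear.greedyCount γ α x X a b : ℝ)
          * Real.log (μ + 1 / (1 - μ))) ∧
      RoughLinear.supNorm y a b ≤
        ‖y a‖ * Real.exp ((RoughLinear.greedyCount γ α x X a b : ℝ)
          * Real.log (μ + 1 / (1 - μ))) := by
  refine ⟨⟨_, RoughLinear.isRoughConst_sewingConst hα⟩, ?_⟩
  intro K hK d m A C f h Cf hf _ _ hh hfh a b hab x X hx y y' hy μ hμ0 hμ γ hγ0 hγ hγM
  have hα0 : 0 < α := by linarith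
  have hα' : α < 1 / 2 := by linarith
  have hex := hx.exists_greedyTime_eq hα0 hα' hαν hγ0 hab.le
  have hcount : RoughLinear.greedyTime γ α x X a b (RoughLinear.greedyCount γ α x X a b) = b :=
    Nat.sInf_mem hex
  have hlt : ∀ i < RoughLinear.greedyCount γ α x X a b,
      RoughLinear.greedyTime γ α x X a b i < b := fun i hi =>
    lt_of_le_of_ne (hx.greedyTime_mem hα0 hα' hαν hγ0 hab.le i).2 fun e =>
      Nat.notMem_of_lt_sInf hi e
  have hCf : 0 ≤ Cf := (hh 0 le_rfl).1.trans (hh 0 le_rfl).2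
  have hf' : ∀ v, ‖f v‖ ≤ Cf * ‖v‖ := fun v => (hfh v).trans <| by
    rw [mul_comm Cf]
    exact mul_le_mul_of_nonneg_left (hh _ (norm_nonneg v)).2 (norm_nonneg v)
  -- The floor 1/2 in `bigM` keeps the divisor positive even if the bracket vanishes.
  have hMpos : 0 < RoughLinear.bigM A Cf C K := lt_of_lt_of_le (by norm_num) (le_max_right _ _)
  have hM : γ * ((‖Matrix.toEuclideanCLM (𝕜 := ℝ) A‖ + Cf
      + ‖RoughLinear.diffusion C‖ * (1 + K)) * (1 + ‖RoughLinear.diffusion C‖)) ≤ μ :=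
    (mul_le_mul_of_nonneg_left (le_max_left _ _) hγ0.le).trans ((le_div_iff₀ hMpos).1 hγM)
  have hμ' : 0 < 1 - μ := by linarith
  have hρ : 0 < 1 / (1 - μ) := by positivity
  obtain ⟨e1, -, e3⟩ := hy.greedy_estimate hα0 hα' hαν hK hab.le hx hf.continuous hCf hf' hγ0 hγ
    hμ0 hμ (one_div_mul_cancel hμ'.ne') hM _ hlt
  rw [hcount] at e1 e3
  have hexp : Real.exp ((RoughLinear.greedyCount γ α x X a b : ℝ)
      * Real.log (μ + 1 / (1 - μ))) = (μ + 1 / (1 - μ)) ^ RoughLinear.greedyCount γ α x X a b := by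
    rw [Real.exp_nat_mul, Real.exp_log (by positivity)]
  rw [hexp, mul_comm ‖y a‖]
  -- The supremum satisfies the sharper bound with base ρ, here weakened to μ + ρ.
  refine ⟨hex, e3, Real.sSup_le ?_ (by positivity)⟩
  rintro _ ⟨t, ht, rfl⟩
  refine (e1 t ht).trans ?_
  gcongr
  linarith
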